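/- **Setting.** Let $H$ be a complex Hilbert space and let $A$ be the generator of a $C_0$-semigroup $(S(t))_{t\ge 0}$ on $H$ that is exponentially stable: there are $\alpha>0$, $M\ge 1$ with $\|S(t)\|\le Me^{-\alpha t}$ for all $t\ge 0$. Assume that $A$ admits a Riesz basis of normalized eigenvectors $(\phi_n)_{n\ge1}$ of $H$, $A\phi_n=-\lambda_n\phi_n$, $\|\phi_n\|=1$, and that $\sum_{n}\frac{\operatorname{Re}\lambda_n}{1+|\lambda_n|^2}<\infty$. (By exponential stability, $\operatorname{Re}\lambda_n>0$ for all $n$.) Let $(b_n)_{n\ge1}\subset\mathbb C$ and let $$H_B=\Big\{x=\sum_{n}x_n\phi_n:\ \|x\|_B^2=\sum_{n}\frac{|x_n|^2}{n^2(1+|b_n|^2)}<\infty\Big\}\supset H ,\qquad Bv=v\sum_{n}\overline{b_n}\,\phi_n\in H_B\quad(v\in\mathbb C).$$ The operators $S(t)$ are extended continuously to $H_B$. The system $x'(t)=Ax(t)+Bu(t)$, $x(0)=x_0\in H$, has the solution $$x(t)=S(t)x_0+\mathcal B_tu,\qquad \mathcal B_tu=\int_0^tS(t-r)Bu(r)\,dr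 ,$$ and we put $\mathcal B_\infty u=\int_0^\infty S(t)Bu(t)\,dt$, all integrals being taken in $H_B$. The system is *exactly controllable in finite time* $\tau>0$ if for all $x_0,x_1\in H$ there is $u\in L^2(0,\tau)$ with $x(0)=x_0$ and $x(\tau)=x_1$ (equivalently, the range of $\mathcal B_\tau$ on $L^2(0,\tau)$ contains $H$). It is *exactly controllable in infinite time* if the range of $\mathcal B_\infty$ on $L^2(0,\infty)$ contains $H$. For $\sigma>0$ let $PW^2_\sigma$ be the space of entire functions of exponential type at most $\sigma$ whose restriction to $\mathbb R$ is in $L^2(\mathbb R)$, and let $H^2_+$ be the Hardy space of the upper half-plane $\mathbb C^+$, i.e. the holomorphic $f$ on $\mathbb C^+$ with $\sup_{y>0}\int_{\mathbb R}|f(x+iy)|^2dx<\infty$. For $X=PW^2_\sigma$ (resp. $X=H^2_+$), a sequence $(\mu_n)$ in $\mathbb C$ (resp. in $\mathbb C^+$) is *$\omega$-interpolating in $X$* if $\omega_n>0$ for all $n$ and for every $(a_n)\in\ell^2$ there is $f\in X$ with $\omega_nf(\mu_n)=a_n$ for all $n$. **Theorem.** (1) For every $\tau>0$, the system is exactly controllable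 in finite time $\tau$ if and only if $i\Lambda=(i\lambda_n)_{n\ge1}$ is $\omega$-interpolating in $PW^2_{\tau/2}$, where $\omega_n=e^{-\frac{\tau}{2}\operatorname{Im}(i\lambda_n)}|b_n|$. (2) The system is exactly controllable in infinite time if and only if $i\Lambda$ is $(|b_n|)_{n\ge1}$-interpolating in $H^2_+$. -/

import Mathlib

open MeasureTheory Filter Topology
open scoped ENNReal NNReal ComplexConjugate

noncomputable section

namespace ExactControl

/-! ### Paley-Wiener and Hardy spaces, weighted interpolation -/

/-- `f` is of exponential type at most `τ`. -/
def ExpTypeAtMost (τ : ℝ) (f : ℂ → ℂ) : Prop :=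
  ∀ ε > 0, ∃ C : ℝ, ∀ z : ℂ, ‖f z‖ ≤ C * Real.exp ((τ + ε) * ‖z‖)

/-- The Paley-Wiener space `PW_τ^p`: entire functions of exponential type at most `τ` whose
restriction to the real line is in `L^p`. -/
def PaleyWiener (p : ℝ≥0∞) (τ : ℝ) : Set (ℂ → ℂ) :=
  {f | Differentiable ℂ f ∧ ExpTypeAtMost τ f ∧ MemLp (fun x : ℝ => f x) p volume}

/-- The Hardy space `H^p_+` of the upper half-plane: functions holomorphic for `Im z > 0` whose
`L^p` norms on horizontal lines are uniformly bounded. Values outside the open upper half-plane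
are irrelevant. -/
def HardyUpper (p : ℝ≥0∞) : Set (ℂ → ℂ) :=
  {f | DifferentiableOn ℂ f {z : ℂ | 0 < z.im} ∧
    ∃ C : ℝ≥0, ∀ y : ℝ, 0 < y →
      eLpNorm (fun x : ℝ => f (x + y * Complex.I)) p volume ≤ C}

/-- The sequence `μ` in the domain `Ω` is `ω`-interpolating in the space `X` of functions on `Ω`
(with data in `ℓ^p`): the weights are strictly positive, and every `a ∈ ℓ^p` is of the form
`ω n * f (μ n) = a n` with `f ∈ X`. -/
def WeightedInterpolating (p : ℝ≥0∞) (Ω : Set ℂ) (X : Set (ℂ → ℂ)) (μ : ℕ → ℂ) (ω : ℕ → ℝ) :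
    Prop :=
  (∀ n, μ n ∈ Ω) ∧ (∀ n, 0 < ω n) ∧
    ∀ a : ℕ → ℂ, Memℓp a p → ∃ f ∈ X, ∀ n, (ω n : ℂ) * f (μ n) = a n

/-! ### Semigroups and Riesz bases -/

section Semigroup

variable {H : Type*} [NormedAddCommGroup H] [InnerProductSpace ℂ H]

/-- `S` is a strongly continuous (`C₀`) semigroup on `H`; only the values `S t`, `t ≥ 0`,
matter. -/
structure IsC0Semigroup (S : ℝ → H →L[ℂ] H) : Prop where
  map_zero : S 0 = ContinuousLinearMap.id ℂ H
  map_add : ∀ s t : ℝ, 0 ≤ s → 0 ≤ t → S (s + t) = (S s).comp (S t)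
  tendsto_zero : ∀ x : H, Tendsto (fun t => S t x) (𝓝[>] 0) (𝓝 x)

/-- The (in general unbounded) operator `A` is the generator of `S`: its graph consists of the
pairs `(x, y)` with `(S t x - x) / t → y` as `t → 0⁺`. -/
def IsGenerator (A : H →ₗ.[ℂ] H) (S : ℝ → H →L[ℂ] H) : Prop :=
  ∀ x y : H, (x, y) ∈ A.graph ↔
    Tendsto (fun t : ℝ => ((t⁻¹ : ℝ) : ℂ) • (S t x - x)) (𝓝[>] 0) (𝓝 y)

/-- Exponential stability of `S`. -/
def ExponentiallyStable (S : ℝ → H →L[ℂ] H) : Prop :=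
  ∃ α > 0, ∃ M ≥ 1, ∀ t : ℝ, 0 ≤ t → ‖S t‖ ≤ M * Real.exp (-α * t)

variable (H) in
/-- A Riesz basis of `H` indexed by `ℕ`: the image of the standard orthonormal basis of `ℓ²` under
a bounded, boundedly invertible linear map. It is given by its coordinate isomorphism. -/
structure RieszBasis where
  repr : H ≃L[ℂ] lp (fun _ : ℕ => ℂ) 2

/-- The `n`-th vector of the Riesz basis. -/
def RieszBasis.vec (φ : RieszBasis H) (n : ℕ) : H :=
  φ.repr.symm (lp.single 2 n (1 : ℂ))

end Semigroup

/-! ### The extrapolation space -/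

section Extrapolation

variable (b : ℕ → ℂ)

/-- The weight `1 / ((n + 1) * √(1 + |b n|²))`. Indices start at `0`, hence `n + 1`. -/
def weight (n : ℕ) : ℝ := 1 / ((n + 1) * √(1 + ‖b n‖ ^ 2))

lemma weight_pos (n : ℕ) : 0 < weight b n := by
  unfold weight; positivity

lemma weight_sq (n : ℕ) :
    weight b n ^ 2 = 1 / (((n : ℝ) + 1) ^ 2 * (1 + ‖b n‖ ^ 2)) := by
  rw [weight, div_pow, mul_pow, Real.sq_sqrt (by positivity), one_pow]

lemma memℓp_weight_iff (x : ℕ → ℂ) :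
    Memℓp (fun n => (weight b n : ℂ) * x n) 2 ↔
      Summable fun n : ℕ => ‖x n‖ ^ 2 / (((n : ℝ) + 1) ^ 2 * (1 + ‖b n‖ ^ 2)) := by
  rw [memℓp_gen_iff (by norm_num)]
  refine summable_congr fun n => ?_
  have h2 : (2 : ℝ≥0∞).toReal = ((2 : ℕ) : ℝ) := by norm_num
  rw [h2, Real.rpow_natCast, norm_mul, mul_pow, Complex.norm_real, Real.norm_eq_abs, sq_abs,
    weight_sq]
  ring

/-- Coefficient sequences `x` with `∑ |x n|² / ((n + 1)² (1 + |b n|²)) < ∞`. -/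
def extrapolationSubmodule : Submodule ℂ (ℕ → ℂ) where
  carrier := {x | Summable fun n : ℕ => ‖x n‖ ^ 2 / (((n : ℝ) + 1) ^ 2 * (1 + ‖b n‖ ^ 2))}
  zero_mem' := by simp
  add_mem' := by
    intro x y hx hy
    simp only [Set.mem_ofPred_eq, ← memℓp_weight_iff] at hx hy ⊢
    convert hx.add hy using 1
    ext n; simp [mul_add]
  smul_mem' := by
    intro c x hx
    simp only [Set.mem_ofPred_eq, ← memℓp_weight_iff] at hx ⊢
    convert hx.const_smul c using 1
    ext n; simp; ring

/-- The extrapolation space `H_B` of formal series `∑ x n • φ n`, identified with their coefficient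
sequences, normed by `‖x‖² = ∑ |x n|² / ((n + 1)² (1 + |b n|²))`, see
`ExtrapolationSpace.norm_sq_eq`. -/
def ExtrapolationSpace : Type := extrapolationSubmodule b

namespace ExtrapolationSpace

instance : AddCommGroup (ExtrapolationSpace b) :=
  inferInstanceAs (AddCommGroup (extrapolationSubmodule b))

instance : Module ℂ (ExtrapolationSpace b) :=
  inferInstanceAs (Module ℂ (extrapolationSubmodule b))

variable {b}

/-- The `n`-th coefficient. -/
def coeff (x : ExtrapolationSpace b) (n : ℕ) : ℂ := x.1 n

variable (b) in
/-- Multiplication of the coefficients by the weights identifies `H_B` with `ℓ²`. -/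
def toL2 : ExtrapolationSpace b ≃ₗ[ℂ] lp (fun _ : ℕ => ℂ) 2 where
  toFun x := ⟨fun n => (weight b n : ℂ) * x.1 n, (memℓp_weight_iff b _).2 x.2⟩
  map_add' x y := by
    ext n
    exact mul_add (weight b n : ℂ) (x.1 n) (y.1 n)
  map_smul' c x := by
    ext n
    exact mul_left_comm (weight b n : ℂ) c (x.1 n)
  invFun y := ⟨fun n => (weight b n : ℂ)⁻¹ * y n, (memℓp_weight_iff b _).1 (by
    have h : (fun n => (weight b n : ℂ) * ((weight b n : ℂ)⁻¹ * y n)) = y := by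
      ext n
      have : (weight b n : ℂ) ≠ 0 := by exact_mod_cast (weight_pos b n).ne'
      field_simp
    rw [h]; exact lp.memℓp y)⟩
  left_inv x := by
    apply Subtype.ext
    ext n
    have : (weight b n : ℂ) ≠ 0 := by exact_mod_cast (weight_pos b n).ne'
    simp [this]
  right_inv y := by
    ext n
    have : (weight b n : ℂ) ≠ 0 := by exact_mod_cast (weight_pos b n).ne'
    simp [this]

instance : NormedAddCommGroup (ExtrapolationSpace b) :=
  NormedAddCommGroup.induced _ _ (toL2 b) (toL2 b).injective

instance : NormedSpace ℂ (ExtrapolationSpace b) :=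
  NormedSpace.induced ℂ _ _ (toL2 b).toLinearMap

lemma isometry_toL2 : Isometry (toL2 b) :=
  AddMonoidHomClass.isometry_of_norm (toL2 b) fun _ => rfl

instance : CompleteSpace (ExtrapolationSpace b) := by
  have h : IsUniformInducing (toL2 b) := isometry_toL2.isUniformInducing
  rw [h.completeSpace_congr (toL2 b).surjective]
  infer_instance

/-- The norm of `H_B`. -/
lemma norm_sq_eq (x : ExtrapolationSpace b) :
    ‖x‖ ^ 2 = ∑' n : ℕ, ‖x.coeff n‖ ^ 2 / (((n : ℝ) + 1) ^ 2 * (1 + ‖b n‖ ^ 2)) := by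
  have h2 : (2 : ℝ≥0∞).toReal = ((2 : ℕ) : ℝ) := by norm_num
  have h := lp.norm_rpow_eq_tsum (p := 2) (by norm_num) (toL2 b x)
  simp only [h2, Real.rpow_natCast] at h
  have h' : ‖x‖ = ‖toL2 b x‖ := rfl
  rw [h', h]
  refine tsum_congr fun n => ?_
  have h3 : toL2 b x n = (weight b n : ℂ) * x.coeff n := rfl
  rw [h3, norm_mul, mul_pow, Complex.norm_real, Real.norm_eq_abs, sq_abs, weight_sq]
  ring

end ExtrapolationSpace

/-- The inclusion of `H` in `H_B`: a vector `∑ a n • φ n` with `a ∈ ℓ²` is sent to its sequence of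
coordinates. -/
def embed {H : Type*} [NormedAddCommGroup H] [InnerProductSpace ℂ H] (φ : RieszBasis H) :
    H →ₗ[ℂ] ExtrapolationSpace b where
  toFun x := ⟨fun n => φ.repr x n, by
    have h := (memℓp_gen_iff (p := 2) (by norm_num)).1 (lp.memℓp (φ.repr x))
    have h2 : (2 : ℝ≥0∞).toReal = ((2 : ℕ) : ℝ) := by norm_num
    simp only [h2, Real.rpow_natCast] at h
    refine Summable.of_nonneg_of_le (fun n => by positivity) (fun n => ?_) h
    refine div_le_self (by positivity) ?_
    nlinarith [sq_nonneg ‖b n‖, sq_nonneg (n : ℝ), (Nat.cast_nonneg n : (0 : ℝ) ≤ n),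
      mul_nonneg (sq_nonneg ((n : ℝ) + 1)) (sq_nonneg ‖b n‖)]⟩
  map_add' x y := by
    apply Subtype.ext
    ext n
    change φ.repr (x + y) n = φ.repr x n + φ.repr y n
    simp
  map_smul' c x := by
    apply Subtype.ext
    ext n
    change φ.repr (c • x) n = c * φ.repr x n
    simp

/-- The control operator `B v = v ∑ conj (b n) • φ n`, with values in `H_B`. -/
def controlOp : ℂ →ₗ[ℂ] ExtrapolationSpace b where
  toFun v := ⟨fun n => v * conj (b n), by
    have h : Summable fun n : ℕ => ‖v‖ ^ 2 * (1 / ((n + 1 : ℕ) : ℝ) ^ 2) :=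
      ((summable_nat_add_iff 1).2 (Real.summable_one_div_nat_pow.2 one_lt_two)).mul_left _
    refine Summable.of_nonneg_of_le (fun n => by positivity) (fun n => ?_) h
    rw [norm_mul, RCLike.norm_conj, mul_pow, mul_div_assoc]
    refine mul_le_mul_of_nonneg_left ?_ (by positivity)
    rw [div_le_div_iff₀ (by positivity) (by positivity)]
    push_cast
    nlinarith [sq_nonneg ((n : ℝ) + 1)]⟩
  map_add' v w := by
    apply Subtype.ext
    ext n
    exact add_mul v w (conj (b n))
  map_smul' c v := by
    apply Subtype.ext
    ext n
    exact mul_assoc c v (conj (b n))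

end Extrapolation

/-! ### The controlled system `x' = A x + B u` -/

section System

variable {H : Type*} [NormedAddCommGroup H] [InnerProductSpace ℂ H]
  (S : ℝ → H →L[ℂ] H) (φ : RieszBasis H) (b : ℕ → ℂ)

/-- The continuous extension to `H_B` of the operator `S t` on the dense subspace `H`. -/
def extendedSemigroup (t : ℝ) : ExtrapolationSpace b →L[ℂ] ExtrapolationSpace b :=
  ((embed b φ).comp (S t).toLinearMap).extendOfNorm (embed b φ)

/-- The controllability operator `𝓑_t u = ∫₀ᵗ S (t - r) B u(r) dr`, an integral in `H_B`. -/
def controllabilityOp (t : ℝ) (u : ℝ → ℂ) : ExtrapolationSpace b :=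
  ∫ r in (0 : ℝ)..t, extendedSemigroup S φ b (t - r) (controlOp b (u r))

/-- The infinite-time controllability operator `𝓑_∞ u = ∫₀^∞ S t B u(t) dt`, an integral
in `H_B`. -/
def controllabilityOpInfty (u : ℝ → ℂ) : ExtrapolationSpace b :=
  ∫ t in Set.Ioi (0 : ℝ), extendedSemigroup S φ b t (controlOp b (u t))

/-- The solution `x(t) = S t x₀ + 𝓑_t u`, in `H_B`. -/
def solution (x₀ : H) (u : ℝ → ℂ) (t : ℝ) : ExtrapolationSpace b :=
  embed b φ (S t x₀) + controllabilityOp S φ b t u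

/-- Exact controllability in finite time `τ`: any `x₀ ∈ H` can be steered to any `x₁ ∈ H` in
time `τ` by an input `u ∈ L²(0, τ)`. -/
def ExactlyControllable (τ : ℝ) : Prop :=
  ∀ x₀ x₁ : H, ∃ u : ℝ → ℂ, MemLp u 2 (volume.restrict (Set.Ioo 0 τ)) ∧
    solution S φ b x₀ u 0 = embed b φ x₀ ∧ solution S φ b x₀ u τ = embed b φ x₁

/-- Exact controllability in infinite time: every `x₁ ∈ H` is of the form `𝓑_∞ u` with
`u ∈ L²(0, ∞)`. -/
def ExactlyControllableInfty : Prop :=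
  ∀ x₁ : H, ∃ u : ℝ → ℂ, MemLp u 2 (volume.restrict (Set.Ioi 0)) ∧
    controllabilityOpInfty S φ b u = embed b φ x₁

end System

end ExactControl

end

/-! The semigroup acts on the coordinates of the Riesz basis as multiplication by `exp (-λ n t)`
(`IsC0Semigroup.apply_eigenvector`, `RieszBasis.repr_apply_of_diagonal`), and so does its extension
to `H_B` (`coeff_extendedSemigroup`). Exponential stability gives `Re λ n ≥ α > 0`, which makes the
integrals defining the controllability operators converge, so that they can be computed
coefficientwise (`coeff_setIntegral_extendedSemigroup`). Both notions of controllability thereby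
become moment problems: for every `a ∈ ℓ²` there is `v ∈ L²(I)` with
`conj (b n) * ∫_I exp (i (i λ n) t) v t dt = a n` for all `n`, where `I` is `(0, τ)` or `(0, ∞)`
(`exactlyControllable_iff`, `exactlyControllableInfty_iff`). Only the moduli of the factors matter
for solvability, and solvability forces them to be nonzero (`SolvesAll.of_norm_eq`,
`SolvesAll.ne_zero`).

It remains to identify the functions `∫_I exp (i z t) v t dt` on the upper half-plane: they are the
functions in `H²` for `I = (0, ∞)`, and `exp (i σ z) f z` with `f` in the Paley–Wiener space of
type `σ` for `I = (0, 2σ)`. That the transforms belong to these spaces follows from Plancherel's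
theorem (`eLpNorm_integral_exp`). For the converses, a holomorphic function with quadratic decay in
the half-plane is represented by the Fourier transform of its boundary values: this is Cauchy's
formula with the kernel `1 / (x - z)` expanded into exponentials (`eq_integral_exp_of_decay`).
A general function is approximated by functions of this kind whose boundary values are bounded in
`L²`. It is first averaged over a short horizontal segment, which makes it bounded on horizontal
lines. In the Hardy space, a shift and a rational factor complete the construction
(`exists_integral_exp_of_hardyUpper`). In the Paley–Wiener space, the Phragmén–Lindelöf principle
bounds the average by `exp (σ |Im z|)`, and a contraction combined with a squared sinc factor gives
the decay while preserving the type, so that the representing functions vanish outside `(0, 2σ)`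
(`exists_integral_exp_of_paleyWiener`). A weak limit of the representing functions solves all the
required equations at once (`exists_weak_limit`). -/

noncomputable section

namespace ExactControl

/-! ### Plancherel's theorem, weak limits and holomorphic integrals -/

open FourierTransform in
/-- On `L¹ ∩ L²` the Fourier integral represents the `L²` Fourier transform, because both are
the Fourier transform in the sense of tempered distributions. -/
lemma fourier_toLp_ae_eq {f : ℝ → ℂ} (hf : Integrable f) (hf2 : MemLp f 2 volume) :
    (𝓕 (hf2.toLp f) : Lp ℂ 2 (volume : Measure ℝ)) =ᵐ[volume] 𝓕 f := by
  have hcont : Continuous (𝓕 f) :=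
    VectorFourier.fourierIntegral_continuous Real.continuous_fourierChar
      (by exact continuous_inner) hf
  refine ae_eq_of_integral_contDiff_smul_eq ((Lp.memLp _).locallyIntegrable one_le_two)
    hcont.locallyIntegrable fun g hg hgc => ?_
  have hgc' : HasCompactSupport (fun x => (g x : ℂ)) :=
    hgc.comp_left (g := fun x : ℝ => (x : ℂ)) (by simp)
  have hg' : ContDiff ℝ (⊤ : ℕ∞) (fun x => (g x : ℂ)) := Complex.ofRealCLM.contDiff.comp hg
  set φ := hgc'.toSchwartzMap hg' with hφ
  have hφx : ∀ x, φ x = (g x : ℂ) := fun x => rfl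
  have h1 := congrArg (fun T => T φ) (Lp.fourier_toTemperedDistribution_eq (hf2.toLp f))
  simp only [TemperedDistribution.fourier_apply, Lp.toTemperedDistribution_apply] at h1
  have h2 : ∫ x, 𝓕 φ x • (hf2.toLp f) x = ∫ x, 𝓕 φ x • f x := by
    refine integral_congr_ae ?_
    filter_upwards [hf2.coeFn_toLp] with x hx
    rw [hx]
  have h3 : ∫ x, 𝓕 φ x • f x = ∫ x, φ x • 𝓕 f x := by
    rw [SchwartzMap.fourier_coe]
    have := VectorFourier.integral_fourierIntegral_smul_eq_flip (L := innerₗ ℝ)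
      (μ := volume) (ν := volume) (f := φ) (g := f) Real.continuous_fourierChar
      (by exact continuous_inner) φ.integrable hf
    rw [flip_innerₗ] at this
    exact this
  rw [h2, h3] at h1
  simpa [hφx] using h1.symm

open FourierTransform in
/-- Plancherel's theorem for the Fourier integral of an integrable `L²` function. -/
lemma eLpNorm_fourier_eq {f : ℝ → ℂ} (hf : Integrable f) (hf2 : MemLp f 2 volume) :
    eLpNorm (𝓕 f) 2 volume = eLpNorm f 2 volume := by
  rw [← eLpNorm_congr_ae (fourier_toLp_ae_eq hf hf2), ← eLpNorm_congr_ae hf2.coeFn_toLp]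
  have h := Lp.norm_fourier_eq (hf2.toLp f)
  rw [Lp.norm_def, Lp.norm_def,
    ENNReal.toReal_eq_toReal_iff' (Lp.memLp _).2.ne (Lp.memLp _).2.ne] at h
  exact h

/-- Dilations act on `L²(ℝ)` by a scalar multiple of an isometry. -/
lemma eLpNorm_two_comp_mul_left (h : ℝ → ℂ) {c : ℝ} (hc : c ≠ 0) :
    eLpNorm (fun x => h (c * x)) 2 volume
      = ENNReal.ofReal |c⁻¹| ^ (1 / 2 : ℝ) * eLpNorm h 2 volume := by
  have he : MeasurableEmbedding (fun x : ℝ => c * x) :=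
    (Homeomorph.mulLeft₀ c hc).measurableEmbedding
  have h1 := he.eLpNorm_map_measure (p := 2) (μ := volume) (g := h)
  rw [Real.map_volume_mul_left hc, eLpNorm_smul_measure_of_ne_top (by norm_num)] at h1
  simpa [Function.comp_def] using h1.symm

/-- Plancherel's theorem in the normalization `x ↦ ∫ exp (i x t) f t dt`. -/
lemma eLpNorm_integral_exp {f : ℝ → ℂ} (hf : Integrable f) (hf2 : MemLp f 2 volume) :
    eLpNorm (fun x : ℝ => ∫ t : ℝ, Complex.exp (Complex.I * x * t) * f t) 2 volume
      = ENNReal.ofReal (2 * Real.pi) ^ (1 / 2 : ℝ) * eLpNorm f 2 volume := by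
  have h1 : (fun x : ℝ => ∫ t : ℝ, Complex.exp (Complex.I * x * t) * f t)
      = fun x : ℝ => FourierTransform.fourier f (-(2 * Real.pi)⁻¹ * x) := by
    ext x
    rw [Real.fourier_eq']
    refine integral_congr_ae (Eventually.of_forall fun t => ?_)
    have hpi : (Real.pi : ℂ) ≠ 0 := by exact_mod_cast Real.pi_ne_zero
    simp only [smul_eq_mul]
    congr 2
    simp only [RCLike.inner_apply, conj_trivial]
    push_cast
    field_simp
  rw [h1, eLpNorm_two_comp_mul_left _ (by simp [Real.pi_ne_zero]), eLpNorm_fourier_eq hf hf2]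
  congr 3
  rw [inv_neg, inv_inv, abs_neg, abs_of_pos (by positivity)]

/-- Weak sequential compactness of balls of `L²`, in the form of a solution of all moment
equations that are satisfied in the limit by a bounded sequence. -/
lemma exists_weak_limit {μ : Measure ℝ} {g : ℕ → ℝ → ℂ} (hg : ∀ j, MemLp (g j) 2 μ)
    {C : ℝ≥0} (hC : ∀ j, eLpNorm (g j) 2 μ ≤ C) :
    ∃ v : ℝ → ℂ, MemLp v 2 μ ∧ ∀ k : ℝ → ℂ, MemLp k 2 μ → ∀ a : ℂ,
      Tendsto (fun j => ∫ t, k t * g j t ∂μ) atTop (𝓝 a) → ∫ t, k t * v t ∂μ = a := by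
  set E := Lp ℂ 2 μ
  -- `k ↦ ∫ k * g j` is the inner product with the conjugate of `g j`
  have hg' : ∀ j, MemLp (fun t => conj (g j t)) 2 μ := fun j => (hg j).star
  set x : ℕ → WeakDual ℂ E := fun j =>
    StrongDual.toWeakDual (InnerProductSpace.toDual ℂ E ((hg' j).toLp _)) with hx
  have hxk : ∀ {k : ℝ → ℂ} (hk : MemLp k 2 μ) j, x j (hk.toLp k) = ∫ t, k t * g j t ∂μ := by
    intro k hk j
    change inner ℂ ((hg' j).toLp _) (hk.toLp k) = _
    rw [L2.inner_def]
    refine integral_congr_ae ?_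
    filter_upwards [hk.coeFn_toLp, (hg' j).coeFn_toLp] with t h1 h2
    rw [h1, h2]
    simp
  have hcpt := WeakDual.isCompact_closedBall (𝕜 := ℂ) (E := E) 0 (C : ℝ)
  obtain ⟨y, -, hy⟩ := hcpt.ultrafilter_le_nhds ((hyperfilter ℕ).map x) (by
    refine le_principal_iff.2 (Eventually.of_forall (f := (hyperfilter ℕ : Filter ℕ))
      (p := fun j => x j ∈ _) fun j => ?_)
    change InnerProductSpace.toDual ℂ E ((hg' j).toLp _) ∈ Metric.closedBall 0 (C : ℝ)
    rw [mem_closedBall_zero_iff, LinearIsometryEquiv.norm_map, Lp.norm_toLp]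
    refine ENNReal.toReal_le_of_le_ofReal C.2 ?_
    have : eLpNorm (fun t => conj (g j t)) 2 μ = eLpNorm (g j) 2 μ :=
      eLpNorm_congr_norm_ae (Eventually.of_forall fun t => by simp)
    rw [this]
    simpa using hC j)
  obtain ⟨w, hw⟩ := (InnerProductSpace.toDual ℂ E).surjective (WeakDual.toStrongDual y)
  refine ⟨fun t => conj (w t), (Lp.memLp w).star, fun k hk a ha => ?_⟩
  have h1 : Tendsto (fun j => x j (hk.toLp k)) (hyperfilter ℕ : Filter ℕ)
      (𝓝 (y (hk.toLp k))) :=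
    ((WeakDual.eval_continuous (hk.toLp k)).tendsto y).comp hy
  have h2 : Tendsto (fun j => x j (hk.toLp k)) (hyperfilter ℕ : Filter ℕ) (𝓝 a) := by
    simp only [hxk hk]
    exact ha.mono_left (by rw [← Nat.cofinite_eq_atTop]; exact hyperfilter_le_cofinite)
  rw [← tendsto_nhds_unique h1 h2]
  have h3 : y (hk.toLp k) = inner ℂ w (hk.toLp k) := by
    rw [← InnerProductSpace.toDual_apply_apply, hw]; rfl
  rw [h3, L2.inner_def]
  refine integral_congr_ae ?_
  filter_upwards [hk.coeFn_toLp] with t h1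
  rw [h1]
  simp

/-- Integrals of holomorphic functions over a parameter are holomorphic, given a locally uniform
integrable bound: Cauchy's estimate turns it into a bound of the derivatives. -/
lemma differentiableOn_integral {α : Type*} [MeasurableSpace α] {μ : Measure α} {U : Set ℂ}
    (hU : IsOpen U) {F : ℂ → α → ℂ} (hmeas : ∀ z ∈ U, AEStronglyMeasurable (F z) μ)
    (hd : ∀ a, DifferentiableOn ℂ (fun z => F z a) U)
    (hb : ∀ z ∈ U, ∃ s ∈ 𝓝 z, ∃ B : α → ℝ, Integrable B μ ∧ ∀ᵐ a ∂μ, ∀ w ∈ s, ‖F w a‖ ≤ B a) :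
    DifferentiableOn ℂ (fun z => ∫ a, F z a ∂μ) U := by
  intro z hz
  obtain ⟨s, hs, B, hB, hsB⟩ := hb z hz
  obtain ⟨r, hr, hrs⟩ := Metric.mem_nhds_iff.1 (Filter.inter_mem hs (hU.mem_nhds hz))
  have hsub : ∀ w ∈ Metric.ball z (r / 2), Metric.closedBall w (r / 4) ⊆ Metric.ball z r := by
    intro w hw u hu
    rw [Metric.mem_ball] at hw ⊢
    rw [Metric.mem_closedBall] at hu
    linarith [dist_triangle u w z]
  have hat : ∀ a, ∀ w ∈ Metric.ball z r, DifferentiableAt ℂ (fun z => F z a) w :=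
    fun a w hw => (hd a).differentiableAt (hU.mem_nhds (hrs hw).2)
  have hmeas' : AEStronglyMeasurable (fun a => deriv (fun z => F z a) z) μ := by
    -- the derivative is a pointwise limit of difference quotients
    set h : ℕ → ℂ := fun n => ((r / 2 / (n + 1) : ℝ) : ℂ) with hh
    have hpos : ∀ n : ℕ, 0 < r / 2 / ((n : ℝ) + 1) := fun n => by positivity
    have hlim : Tendsto h atTop (𝓝[≠] 0) := by
      refine tendsto_nhdsWithin_iff.2 ⟨?_, Eventually.of_forall fun n => ?_⟩
      · have : Tendsto (fun n : ℕ => r / 2 / ((n : ℝ) + 1)) atTop (𝓝 0) := by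
          have := (tendsto_one_div_add_atTop_nhds_zero_nat (𝕜 := ℝ)).const_mul (r / 2)
          simpa only [mul_one_div, mul_zero] using this
        exact (Complex.continuous_ofReal.tendsto' 0 0 rfl).comp this
      · exact Complex.ofReal_ne_zero.2 (hpos n).ne'
    refine aestronglyMeasurable_of_tendsto_ae atTop
      (f := fun n a => (h n)⁻¹ • (F (z + h n) a - F z a)) (fun n => ?_)
      (Eventually.of_forall fun a => ?_)
    · refine AEStronglyMeasurable.const_smul ((hmeas _ ?_).sub (hmeas z hz)) ((h n)⁻¹)
      refine (hrs ?_).2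
      rw [Metric.mem_ball, dist_self_add_left, Complex.norm_real, Real.norm_eq_abs,
        abs_of_pos (hpos n)]
      have : r / 2 / ((n : ℝ) + 1) ≤ r / 2 := 
        div_le_self (by positivity) (by linarith [n.cast_nonneg (α := ℝ)])
      linarith
    · exact (hat a z (Metric.mem_ball_self hr)).hasDerivAt.tendsto_slope_zero.comp hlim
  refine (hasDerivAt_integral_of_dominated_loc_of_deriv_le (𝕜 := ℂ)
    (F' := fun w a => deriv (fun z => F z a) w) (bound := fun a => B a / (r / 4))
    (Metric.ball_mem_nhds z (half_pos hr)) ?_ ?_ hmeas' ?_ (hB.div_const _)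
    ?_).2.differentiableAt.differentiableWithinAt
  · filter_upwards [hU.mem_nhds hz] with w hw using hmeas w hw
  · exact hB.mono' (hmeas z hz) (hsB.mono fun a ha => ha z (mem_of_mem_nhds hs))
  · filter_upwards [hsB] with a ha w hw
    refine Complex.norm_deriv_le_of_forall_mem_sphere_norm_le (by positivity) ?_ ?_
    · refine DifferentiableOn.diffContOnCl fun u hu => ?_
      exact (hat a u (hsub w hw (Metric.closure_ball_subset_closedBall hu))).differentiableWithinAt
    · exact fun u hu => ha u (hrs (hsub w hw (Metric.sphere_subset_closedBall hu))).1
  · refine Eventually.of_forall fun a w hw => ?_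
    refine (hat a w (hsub w hw (Metric.mem_closedBall_self (by positivity)))).hasDerivAt

/-! ### Contour integration in the half-plane -/

/-- A continuous function on the closed upper half-plane which is `O(|z|⁻²)` at infinity is
bounded by a multiple of `1 / (1 + |z|²)`. -/
lemma exists_bound_of_decay {h : ℂ → ℂ} (hc : ContinuousOn h {z | 0 ≤ z.im}) {R C : ℝ}
    (hb : ∀ z : ℂ, 0 ≤ z.im → R ≤ ‖z‖ → ‖h z‖ ≤ C / ‖z‖ ^ 2) :
    ∃ K, 0 ≤ K ∧ ∀ z : ℂ, 0 ≤ z.im → ‖h z‖ ≤ K / (1 + ‖z‖ ^ 2) := by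
  set R' := max R 1
  have hcpt : IsCompact (Metric.closedBall (0 : ℂ) R' ∩ {z | 0 ≤ z.im}) :=
    (isCompact_closedBall 0 R').inter_right (isClosed_le continuous_const Complex.continuous_im)
  obtain ⟨B, hB⟩ := hcpt.exists_bound_of_continuousOn (hc.mono Set.inter_subset_right)
  refine ⟨max (|B| * (1 + R' ^ 2)) (2 * |C|), le_max_of_le_right (by positivity), fun z hz => ?_⟩
  rw [le_div_iff₀ (by positivity)]
  rcases le_total ‖z‖ R' with h1 | h1
  · refine le_trans ?_ (le_max_left _ _)
    have h2 := (hB z ⟨by simpa using h1, hz⟩).trans (le_abs_self B)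
    gcongr
  · refine le_trans ?_ (le_max_right _ _)
    have h2 : 1 ≤ ‖z‖ := (le_max_right _ _).trans h1
    have h3 := hb z hz ((le_max_left _ _).trans h1)
    have h4 : ‖h z‖ * ‖z‖ ^ 2 ≤ C := by rwa [le_div_iff₀ (by positivity)] at h3
    have h5 : ‖h z‖ ≤ ‖h z‖ * ‖z‖ ^ 2 :=
      le_mul_of_one_le_right (norm_nonneg _) (one_le_pow₀ h2)
    linarith [le_abs_self C]

lemma norm_ofReal_sq (x : ℝ) : ‖(x : ℂ)‖ ^ 2 = x ^ 2 := by
  rw [Complex.norm_real, Real.norm_eq_abs, sq_abs]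

/-- The restriction to `ℝ` of a function with quadratic decay is integrable. -/
lemma integrable_of_decay {h : ℂ → ℂ} (hc : ContinuousOn h {z | 0 ≤ z.im}) {K : ℝ}
    (hb : ∀ z : ℂ, 0 ≤ z.im → ‖h z‖ ≤ K / (1 + ‖z‖ ^ 2)) :
    Integrable (fun x : ℝ => h x) := by
  have hcr : Continuous (fun x : ℝ => h x) :=
    hc.comp_continuous Complex.continuous_ofReal fun x => by simp
  refine (integrable_inv_one_add_sq.const_mul K).mono' hcr.aestronglyMeasurable
    (Eventually.of_forall fun x => ?_)
  have := hb x (by simp)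
  rwa [norm_ofReal_sq, div_eq_mul_inv] at this

/-- **Cauchy's theorem for the half-plane**: the integral over the real line of a holomorphic
function with quadratic decay vanishes. -/
lemma integral_eq_zero_of_decay {h : ℂ → ℂ} (hc : ContinuousOn h {z | 0 ≤ z.im})
    (hd : DifferentiableOn ℂ h {z | 0 < z.im}) {R C : ℝ}
    (hb : ∀ z : ℂ, 0 ≤ z.im → R ≤ ‖z‖ → ‖h z‖ ≤ C / ‖z‖ ^ 2) :
    ∫ x : ℝ, h x = 0 := by
  obtain ⟨K, hK, hb'⟩ := exists_bound_of_decay hc hb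
  have hint := integrable_of_decay hc hb'
  have h1 : Tendsto (fun R : ℝ => ∫ x : ℝ in -R..R, h x) atTop (𝓝 (∫ x : ℝ, h x)) :=
    intervalIntegral_tendsto_integral hint tendsto_neg_atTop_atBot tendsto_id
  have h2 : Tendsto (fun R : ℝ => ∫ x : ℝ in -R..R, h x) atTop (𝓝 0) := by
    refine squeeze_zero_norm' (a := fun R : ℝ => 4 * K * R⁻¹) ?_
      (by simpa using tendsto_inv_atTop_zero.const_mul (4 * K))
    filter_upwards [eventually_gt_atTop 0] with R hR
    have hrect := Complex.integral_boundary_rect_eq_zero_of_continuousOn_of_differentiableOn h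
      (-R : ℝ) ((R : ℝ) + (R : ℝ) * Complex.I)
      (hc.mono fun z hz => by
        have := hz.2
        simp [Set.uIcc_of_le hR.le] at this
        exact this.1)
      (hd.mono fun z hz => by
        have := hz.2
        simp [hR.le] at this
        exact this.1)
    simp only [Complex.ofReal_re, Complex.ofReal_im, Complex.add_re, Complex.add_im,
      Complex.mul_re, Complex.mul_im, Complex.I_re, Complex.I_im, mul_zero, mul_one, zero_mul,
      sub_zero, add_zero, zero_add, Complex.ofReal_zero, smul_eq_mul] at hrect
    have hside : ∀ z : ℂ, 0 ≤ z.im → R ≤ ‖z‖ → ‖h z‖ ≤ K / R ^ 2 := fun z hz hRz => by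
      refine (hb' z hz).trans (div_le_div_of_nonneg_left hK (by positivity) ?_)
      nlinarith
    have t1 : ‖∫ x : ℝ in -R..R, h (x + R * Complex.I)‖ ≤ K / R ^ 2 * |R - -R| := by
      refine intervalIntegral.norm_integral_le_of_norm_le_const fun x _ => hside _ ?_ ?_
      · simpa using hR.le
      · refine le_trans ?_ (Complex.abs_im_le_norm _)
        simp [le_abs_self]
    have t2 : ∀ s : ℝ, |s| = R → ‖∫ y : ℝ in (0 : ℝ)..R, h (s + y * Complex.I)‖
        ≤ K / R ^ 2 * |R - 0| := by
      intro s hs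
      refine intervalIntegral.norm_integral_le_of_norm_le_const fun y hy => hside _ ?_ ?_
      · rw [Set.uIoc_of_le hR.le] at hy
        simpa using hy.1.le
      · refine le_trans ?_ (Complex.abs_re_le_norm _)
        simp [hs]
    have t3 := t2 R (abs_of_pos hR)
    have t4 := t2 (-R) (by rw [abs_neg, abs_of_pos hR])
    have e : ∫ x : ℝ in -R..R, h x = (∫ x : ℝ in -R..R, h (x + R * Complex.I))
        - Complex.I * (∫ y : ℝ in (0 : ℝ)..R, h (R + y * Complex.I))
        + Complex.I * (∫ y : ℝ in (0 : ℝ)..R, h ((-R : ℝ) + y * Complex.I)) := by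
      linear_combination hrect
    rw [e]
    refine (norm_add_le _ _).trans ((add_le_add_left (norm_sub_le _ _) _).trans ?_)
    rw [norm_mul, norm_mul, Complex.norm_I, one_mul, one_mul]
    rw [sub_neg_eq_add, abs_of_pos (by linarith)] at t1
    rw [sub_zero, abs_of_pos hR] at t3 t4
    have e2 : K / R ^ 2 * (R + R) + K / R ^ 2 * R + K / R ^ 2 * R = 4 * K * R⁻¹ := by
      field_simp; ring
    linarith
  exact tendsto_nhds_unique h1 h2

/-- The mass of the Poisson kernel. -/
lemma integral_inv_normSq {z : ℂ} (hz : 0 < z.im) :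
    ∫ x : ℝ, (((x : ℂ) - z) * ((x : ℂ) - conj z))⁻¹ = Real.pi / z.im := by
  have h1 : ∀ x : ℝ, (((x : ℂ) - z) * ((x : ℂ) - conj z))⁻¹
      = (((z.im ^ 2)⁻¹ * (1 + ((z.im)⁻¹ * (x - z.re)) ^ 2)⁻¹ : ℝ) : ℂ) := by
    intro x
    have e : ((x : ℂ) - z) * ((x : ℂ) - conj z) = (((x - z.re) ^ 2 + z.im ^ 2 : ℝ) : ℂ) := by
      apply Complex.ext <;> simp [pow_two]; ring
    rw [e, ← Complex.ofReal_inv]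
    congr 1
    rw [← mul_inv]
    congr 1
    field_simp
    ring
  simp_rw [h1]
  rw [integral_complex_ofReal, integral_const_mul,
    integral_sub_right_eq_self (fun x : ℝ => (1 + ((z.im)⁻¹ * x) ^ 2)⁻¹) z.re,
    Measure.integral_comp_mul_left (fun x : ℝ => (1 + x ^ 2)⁻¹), integral_univ_inv_one_add_sq,
    inv_inv, abs_of_pos hz]
  have : (z.im : ℂ) ≠ 0 := by exact_mod_cast hz.ne'
  push_cast
  simp only [smul_eq_mul]
  push_cast
  field_simp

lemma im_le_norm_sub_conj {z w : ℂ} (hw : 0 ≤ w.im) : z.im ≤ ‖w - conj z‖ := by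
  refine le_trans ?_ (Complex.abs_im_le_norm _)
  refine le_trans ?_ (le_abs_self _)
  simp [hw]

/-- **Cauchy's formula for the half-plane.** -/
lemma integral_div_sub_eq {G : ℂ → ℂ} {δ : ℝ} (hδ : 0 < δ)
    (hd : DifferentiableOn ℂ G {z | -δ < z.im}) {R C : ℝ}
    (hb : ∀ z : ℂ, 0 ≤ z.im → R ≤ ‖z‖ → ‖G z‖ ≤ C / ‖z‖ ^ 2) {z : ℂ} (hz : 0 < z.im) :
    ∫ x : ℝ, G x / (x - z) = 2 * Real.pi * Complex.I * G z := by
  have hopen : IsOpen {w : ℂ | -δ < w.im} := isOpen_lt continuous_const Complex.continuous_im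
  have hsub : {w : ℂ | 0 ≤ w.im} ⊆ {w : ℂ | -δ < w.im} := fun w hw => by
    simp only [Set.mem_ofPred_eq] at hw ⊢; linarith
  have hsub' : {w : ℂ | 0 < w.im} ⊆ {w : ℂ | 0 ≤ w.im} :=
    fun w (hw : 0 < w.im) => hw.le
  obtain ⟨K, hK, hbK⟩ := exists_bound_of_decay (hd.continuousOn.mono hsub) hb
  have hGint := integrable_of_decay (hd.continuousOn.mono hsub) hbK
  have hne : ∀ w : ℂ, 0 ≤ w.im → w - conj z ≠ 0 := fun w hw => by
    rw [← norm_pos_iff]; exact hz.trans_le (im_le_norm_sub_conj hw)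
  have hdc : DifferentiableOn ℂ (fun w : ℂ => w - conj z) {w | 0 ≤ w.im} := by fun_prop
  -- the reflected point contributes nothing
  have h1d : DifferentiableOn ℂ (fun w => G w / (w - conj z)) {w | 0 ≤ w.im} :=
    (hd.mono hsub).div hdc hne
  have h1b : ∀ w : ℂ, 0 ≤ w.im → R ≤ ‖w‖ → ‖G w / (w - conj z)‖ ≤ (C / z.im) / ‖w‖ ^ 2 := by
    intro w hw hRw
    rw [norm_div, div_right_comm]
    exact div_le_div₀ ((norm_nonneg _).trans (hb w hw hRw)) (hb w hw hRw) hz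
      (im_le_norm_sub_conj hw)
  have h1 : ∫ x : ℝ, G x / (x - conj z) = 0 :=
    integral_eq_zero_of_decay (h := fun w => G w / (w - conj z)) h1d.continuousOn
      (h1d.mono hsub') h1b
  -- the Poisson kernel reproduces the value
  have hzmem : {w : ℂ | -δ < w.im} ∈ 𝓝 z :=
    hopen.mem_nhds (by simp only [Set.mem_ofPred_eq]; linarith)
  have h2d : DifferentiableOn ℂ (fun w => dslope G z w / (w - conj z)) {w | 0 ≤ w.im} :=
    (((Complex.differentiableOn_dslope hzmem).2 hd).mono hsub).div hdc hne
  have h2b : ∀ w : ℂ, 0 ≤ w.im → 2 * ‖z‖ + 1 ≤ ‖w‖ →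
      ‖dslope G z w / (w - conj z)‖ ≤ (8 * K) / ‖w‖ ^ 2 := by
    intro w hw hzw
    have hz0 := norm_nonneg z
    have hwz : w ≠ z := by rintro rfl; linarith
    have n1 : ‖w‖ / 2 ≤ ‖w - z‖ := by linarith [norm_sub_norm_le w z]
    have n2 : ‖w‖ / 2 ≤ ‖w - conj z‖ := by
      have := norm_sub_norm_le w (conj z)
      rw [Complex.norm_conj] at this
      linarith
    have n3 : ∀ u : ℂ, 0 ≤ u.im → ‖G u‖ ≤ K := fun u hu =>
      (hbK u hu).trans (div_le_self hK (by nlinarith [sq_nonneg ‖u‖]))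
    rw [dslope_of_ne _ hwz, slope_def_field, div_div, norm_div, norm_mul]
    have hw0 : 0 < ‖w‖ := by linarith
    calc ‖G w - G z‖ / (‖w - z‖ * ‖w - conj z‖)
        ≤ (K + K) / (‖w‖ / 2 * (‖w‖ / 2)) := by
          refine div_le_div₀ (by linarith) ((norm_sub_le _ _).trans
            (add_le_add (n3 w hw) (n3 z hz.le))) (by positivity) (by gcongr)
      _ = 8 * K / ‖w‖ ^ 2 := by field_simp; ring
  have h2 : ∫ x : ℝ, dslope G z x / (x - conj z) = 0 :=
    integral_eq_zero_of_decay (h := fun w => dslope G z w / (w - conj z)) h2d.continuousOn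
      (h2d.mono hsub') h2b
  have hxz : ∀ x : ℝ, (x : ℂ) - z ≠ 0 := fun x h => by
    have := congrArg Complex.im h
    simp at this; linarith
  have hxz' : ∀ x : ℝ, (x : ℂ) - conj z ≠ 0 := fun x => hne x (by simp)
  have hzz : z - conj z = 2 * z.im * Complex.I := by
    rw [Complex.sub_conj]; push_cast; ring
  obtain ⟨K1, -, hK1⟩ := exists_bound_of_decay h1d.continuousOn h1b
  obtain ⟨K2, -, hK2⟩ := exists_bound_of_decay h2d.continuousOn h2b
  have i1 := integrable_of_decay h1d.continuousOn hK1
  have i2 := integrable_of_decay h2d.continuousOn hK2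
  have i3 : Integrable (fun x : ℝ => (((x : ℂ) - z) * ((x : ℂ) - conj z))⁻¹) := by
    refine Integrable.of_integral_ne_zero ?_
    rw [integral_inv_normSq hz]
    have : (z.im : ℂ) ≠ 0 := by exact_mod_cast hz.ne'
    have : (Real.pi : ℂ) ≠ 0 := by exact_mod_cast Real.pi_ne_zero
    positivity
  have hsplit : ∀ x : ℝ, G x / (x - z) = G x / (x - conj z)
      + ((2 * z.im * Complex.I) * (dslope G z x / (x - conj z))
        + (2 * z.im * Complex.I * G z) * (((x : ℂ) - z) * ((x : ℂ) - conj z))⁻¹) := by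
    intro x
    rw [dslope_of_ne _ (fun h => hxz x (by rw [h, sub_self])), slope_def_field, ← hzz]
    have a1 := hxz x
    have a2 := hxz' x
    field_simp
    ring
  have i23 : Integrable (fun x : ℝ => (2 * z.im * Complex.I) * (dslope G z x / (x - conj z))
      + (2 * z.im * Complex.I * G z) * (((x : ℂ) - z) * ((x : ℂ) - conj z))⁻¹) :=
    (i2.const_mul (2 * z.im * Complex.I)).add (i3.const_mul (2 * z.im * Complex.I * G z))
  simp_rw [hsplit]
  rw [integral_add i1 i23, integral_add (i2.const_mul _) (i3.const_mul _), integral_const_mul,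
    integral_const_mul, h1, h2, integral_inv_normSq hz]
  have : (z.im : ℂ) ≠ 0 := by exact_mod_cast hz.ne'
  field_simp
  ring

/-- The normalized Fourier transform of the restriction of `G` to the real line. -/
def boundaryTransform (G : ℂ → ℂ) (t : ℝ) : ℂ :=
  (2 * Real.pi)⁻¹ * ∫ x : ℝ, Complex.exp (Complex.I * (-t : ℝ) * x) * G x

/-- A holomorphic function with quadratic decay in the upper half-plane is the Fourier–Laplace
transform of the Fourier transform of its boundary values: expand the Cauchy kernel as
`1 / (x - z) = i ∫₀^∞ exp (i (z - x) t) dt`. -/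
lemma eq_integral_exp_of_decay {G : ℂ → ℂ} {δ : ℝ} (hδ : 0 < δ)
    (hd : DifferentiableOn ℂ G {z | -δ < z.im}) {R C : ℝ}
    (hb : ∀ z : ℂ, 0 ≤ z.im → R ≤ ‖z‖ → ‖G z‖ ≤ C / ‖z‖ ^ 2) {z : ℂ} (hz : 0 < z.im) :
    ∫ t in Set.Ioi (0 : ℝ), Complex.exp (Complex.I * z * t) *
      boundaryTransform G t = G z := by
  have hsub : {w : ℂ | 0 ≤ w.im} ⊆ {w : ℂ | -δ < w.im} := fun w hw => by
    simp only [Set.mem_ofPred_eq] at hw ⊢; linarith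
  obtain ⟨K, hK, hbK⟩ := exists_bound_of_decay (hd.continuousOn.mono hsub) hb
  have hGint := integrable_of_decay (hd.continuousOn.mono hsub) hbK
  have hre : ∀ x : ℝ, (Complex.I * (z - x)).re < 0 := fun x => by simpa using hz
  have hzre : (Complex.I * z).re < 0 := by simpa using hz
  have hker : ∀ x : ℝ, G x / (x - z) = Complex.I *
      ∫ t in Set.Ioi (0 : ℝ), Complex.exp (Complex.I * (z - x) * t) * G x := by
    intro x
    rw [integral_mul_const, integral_exp_mul_complex_Ioi (hre x)]
    have h0 : (x : ℂ) - z ≠ 0 := fun h => by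
      have := congrArg Complex.im h
      simp at this; linarith
    have h0' : z - (x : ℂ) ≠ 0 := fun h => h0 (by rw [← neg_sub, h, neg_zero])
    simp only [Complex.ofReal_zero, mul_zero, Complex.exp_zero]
    field_simp
    ring
  -- the double integral converges absolutely, as `exp (i (z - x) t)` has modulus `exp (-Im z * t)`
  have hprod : Integrable (Function.uncurry fun (x t : ℝ) =>
      Complex.exp (Complex.I * (z - x) * t) * G x)
      (volume.prod (volume.restrict (Set.Ioi (0 : ℝ)))) := by
    have hp := hGint.mul_prod (integrableOn_exp_mul_complex_Ioi hzre 0)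
    have hp' := hp.bdd_mul (c := 1)
      (f := fun p : ℝ × ℝ => Complex.exp (-(Complex.I * p.1 * p.2)))
      (Continuous.aestronglyMeasurable (by fun_prop)) (Eventually.of_forall fun p => by
        rw [Complex.norm_exp]; simp)
    refine hp'.congr (Eventually.of_forall fun p => ?_)
    simp only [Function.uncurry]
    rw [mul_comm (G _), ← mul_assoc, ← Complex.exp_add]
    congr 2
    ring
  have key := integral_div_sub_eq hδ hd hb hz
  simp_rw [hker] at key
  rw [integral_const_mul, integral_integral_swap hprod] at key
  have hpi : (Real.pi : ℂ) ≠ 0 := by exact_mod_cast Real.pi_ne_zero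
  have key' : ∫ t in Set.Ioi (0 : ℝ), ∫ x : ℝ, Complex.exp (Complex.I * (z - x) * t) * G x
      = 2 * Real.pi * G z := by
    refine mul_left_cancel₀ Complex.I_ne_zero ?_
    rw [key]; ring
  have : ∀ t : ℝ, Complex.exp (Complex.I * z * t) * boundaryTransform G t
      = (2 * Real.pi)⁻¹ * ∫ x : ℝ, Complex.exp (Complex.I * (z - x) * t) * G x := by
    intro t
    rw [boundaryTransform, mul_left_comm, ← integral_const_mul]
    congr 2
    ext x
    rw [← mul_assoc, ← Complex.exp_add]
    congr 2
    push_cast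
    ring
  simp_rw [this]
  rw [integral_const_mul, key']
  push_cast
  field_simp

/-! ### Averages over horizontal segments -/

lemma eLpNorm_two_sq {α : Type*} [MeasurableSpace α] (f : α → ℂ) (μ : Measure α) :
    eLpNorm f 2 μ ^ 2 = ∫⁻ x, ‖f x‖ₑ ^ 2 ∂μ := by
  have h := eLpNorm_nnreal_pow_eq_lintegral (μ := μ) (f := f) (p := 2) two_ne_zero
  simpa using h

lemma enorm_integral_le_eLpNorm_two {α : Type*} [MeasurableSpace α] {μ : Measure α}
    [IsProbabilityMeasure μ] {f : α → ℂ} (hf : AEStronglyMeasurable f μ) :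
    ‖∫ a, f a ∂μ‖ₑ ≤ eLpNorm f 2 μ := by
  refine (enorm_integral_le_lintegral_enorm f).trans ?_
  rw [← eLpNorm_one_eq_lintegral_enorm]
  exact eLpNorm_le_eLpNorm_of_exponent_le one_le_two hf

instance isProbabilityMeasure_restrict_Ioc_zero_one :
    IsProbabilityMeasure (volume.restrict (Set.Ioc (0 : ℝ) 1)) := ⟨by simp⟩

/-- The mean of `F` over the horizontal segment `[z, z + h]`. -/
def segmentMean (h : ℝ) (F : ℂ → ℂ) (z : ℂ) : ℂ :=
  ∫ s in Set.Ioc (0 : ℝ) 1, F (z + (h * s : ℝ))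

/-- Averages of an `L²` function over intervals of fixed length are bounded. -/
lemma enorm_integral_comp_segment_le {f : ℝ → ℂ} (hf : Continuous f) {h : ℝ} (hh : h ≠ 0)
    (x : ℝ) :
    ‖∫ s in Set.Ioc (0 : ℝ) 1, f (x + h * s)‖ₑ
      ≤ ENNReal.ofReal |h⁻¹| ^ (1 / 2 : ℝ) * eLpNorm f 2 volume := by
  refine (enorm_integral_le_eLpNorm_two (Continuous.aestronglyMeasurable (by fun_prop))).trans ?_
  refine (eLpNorm_restrict_le _ _ _ _).trans ?_
  rw [eLpNorm_two_comp_mul_left (fun s => f (x + s)) hh]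
  have := eLpNorm_comp_measurePreserving (p := 2) (hf.aestronglyMeasurable (μ := volume))
    (measurePreserving_add_left volume x)
  rw [← this]
  rfl

/-- Averaging over translates does not increase the `L²` norm. -/
lemma eLpNorm_integral_comp_segment_le {f : ℝ → ℂ} (hf : Continuous f) (h : ℝ) :
    eLpNorm (fun x => ∫ s in Set.Ioc (0 : ℝ) 1, f (x + h * s)) 2 volume ≤ eLpNorm f 2 volume := by
  rw [← ENNReal.pow_le_pow_left_iff two_ne_zero, eLpNorm_two_sq]
  calc ∫⁻ x, ‖∫ s in Set.Ioc (0 : ℝ) 1, f (x + h * s)‖ₑ ^ 2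
      ≤ ∫⁻ x, ∫⁻ s in Set.Ioc (0 : ℝ) 1, ‖f (x + h * s)‖ₑ ^ 2 := by
        refine lintegral_mono fun x => ?_
        rw [← eLpNorm_two_sq]
        gcongr
        exact enorm_integral_le_eLpNorm_two (Continuous.aestronglyMeasurable (by fun_prop))
    _ = ∫⁻ s in Set.Ioc (0 : ℝ) 1, ∫⁻ x, ‖f (x + h * s)‖ₑ ^ 2 := by
        refine lintegral_lintegral_swap (Measurable.aemeasurable ?_)
        exact (Continuous.measurable (by fun_prop : Continuous fun p : ℝ × ℝ =>
          f (p.1 + h * p.2))).enorm.pow_const 2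
    _ = ∫⁻ _ in Set.Ioc (0 : ℝ) 1, eLpNorm f 2 volume ^ 2 := by
        refine lintegral_congr fun s => ?_
        rw [eLpNorm_two_sq, lintegral_add_right_eq_self (fun x => ‖f x‖ₑ ^ 2)]
    _ = eLpNorm f 2 volume ^ 2 := by simp

lemma continuous_segment_comp {F : ℂ → ℂ} {U : Set ℂ} (hUtr : ∀ z ∈ U, ∀ x : ℝ, z + x ∈ U)
    (hF : ContinuousOn F U) (h : ℝ) {z : ℂ} (hz : z ∈ U) :
    Continuous fun s : ℝ => F (z + (h * s : ℝ)) :=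
  hF.comp_continuous (by fun_prop) fun s => hUtr z hz _

lemma differentiableOn_segmentMean {F : ℂ → ℂ} {U : Set ℂ} (hU : IsOpen U)
    (hUtr : ∀ z ∈ U, ∀ x : ℝ, z + x ∈ U) (hF : DifferentiableOn ℂ F U) (h : ℝ) :
    DifferentiableOn ℂ (segmentMean h F) U := by
  refine differentiableOn_integral hU
    (fun z hz => (continuous_segment_comp hUtr hF.continuousOn h hz).aestronglyMeasurable)
    (fun s => hF.comp (by fun_prop) fun z hz => hUtr z hz _) fun z hz => ?_
  set K : Set ℂ := (fun s : ℝ => z + (h * s : ℝ)) '' Set.Icc 0 1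
  have hK : IsCompact K := isCompact_Icc.image (by fun_prop)
  have hKU : K ⊆ U := by rintro _ ⟨s, -, rfl⟩; exact hUtr z hz _
  obtain ⟨δ, hδ, hδU⟩ := hK.exists_cthickening_subset_open hU hKU
  obtain ⟨B, hB⟩ := (hK.cthickening (r := δ)).exists_bound_of_continuousOn
    (hF.continuousOn.mono hδU)
  refine ⟨Metric.closedBall z δ, Metric.closedBall_mem_nhds z hδ, fun _ => B,
    integrable_const _, ?_⟩
  refine (ae_restrict_iff' measurableSet_Ioc).2 (Eventually.of_forall fun s hs w hw => hB _ ?_)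
  refine Metric.mem_cthickening_of_dist_le _ (z + (h * s : ℝ)) _ _
    ⟨s, Set.Ioc_subset_Icc_self hs, rfl⟩ ?_
  rwa [dist_add_right]

lemma tendsto_segmentMean {F : ℂ → ℂ} {U : Set ℂ} (hU : IsOpen U)
    (hUtr : ∀ z ∈ U, ∀ x : ℝ, z + x ∈ U) (hF : ContinuousOn F U) {z : ℂ} (hz : z ∈ U)
    {w : ℕ → ℂ} (hw : Tendsto w atTop (𝓝 z)) {h : ℕ → ℝ} (hh : Tendsto h atTop (𝓝 0)) :
    Tendsto (fun j => segmentMean (h j) F (w j)) atTop (𝓝 (F z)) := by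
  rw [Metric.tendsto_atTop']
  intro ε hε
  obtain ⟨δ, hδ, hδF⟩ := Metric.continuousAt_iff.1 (hF.continuousAt (hU.mem_nhds hz)) (ε / 2)
    (half_pos hε)
  have e1 := Metric.tendsto_nhds.1 hw (δ / 2) (half_pos hδ)
  have e2 := Metric.tendsto_nhds.1 hh (δ / 2) (half_pos hδ)
  have e3 := hw.eventually (hU.mem_nhds hz)
  obtain ⟨N, hN⟩ := eventually_atTop.1 (e1.and (e2.and e3))
  refine ⟨N, fun j hj => ?_⟩
  obtain ⟨h1, h2, h3⟩ := hN j hj.le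
  have hint : IntegrableOn (fun s : ℝ => F (w j + (h j * s : ℝ))) (Set.Ioc 0 1) :=
    (continuous_segment_comp hUtr hF (h j) h3).integrableOn_Ioc
  have hc : F z = ∫ _ in Set.Ioc (0 : ℝ) 1, F z := by simp
  rw [dist_eq_norm, segmentMean, hc, ← integral_sub hint (integrable_const _)]
  refine lt_of_le_of_lt (norm_setIntegral_le_of_norm_le_const (C := ε / 2) (by simp)
    fun s hs => ?_) (by simpa using half_lt_self hε)
  rw [← dist_eq_norm]
  refine (hδF ?_).le
  rw [Real.dist_eq, sub_zero] at h2
  calc dist (w j + (h j * s : ℝ)) z ≤ dist (w j + (h j * s : ℝ)) (w j) + dist (w j) z :=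
        dist_triangle _ _ _
    _ < δ / 2 + δ / 2 := by
        refine add_lt_add ?_ h1
        rw [dist_eq_norm, add_sub_cancel_left, Complex.norm_real, Real.norm_eq_abs, abs_mul,
          abs_of_pos hs.1]
        exact (mul_le_of_le_one_right (abs_nonneg _) hs.2).trans_lt h2
    _ = δ := add_halves δ

/-! ### The Fourier transform of boundary values -/

/-- The norm of the normalized Fourier transform on `L²(ℝ)`. -/
def transformConst : ℝ≥0 := Real.toNNReal ((2 * Real.pi)⁻¹ * (2 * Real.pi) ^ (1 / 2 : ℝ))

lemma eLpNorm_boundaryTransform {G : ℂ → ℂ} (hG : Integrable fun x : ℝ => G x)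
    (hG2 : MemLp (fun x : ℝ => G x) 2 volume) :
    eLpNorm (boundaryTransform G) 2 volume
      = transformConst * eLpNorm (fun x : ℝ => G x) 2 volume := by
  have h1 : boundaryTransform G = ((2 * Real.pi)⁻¹ : ℂ) • fun t : ℝ =>
      (fun y : ℝ => ∫ x : ℝ, Complex.exp (Complex.I * y * x) * G x) (-1 * t) := by
    ext t
    simp [boundaryTransform]
  rw [h1, eLpNorm_const_smul, eLpNorm_two_comp_mul_left
      (fun y : ℝ => ∫ x : ℝ, Complex.exp (Complex.I * y * x) * G x) (by norm_num),
    eLpNorm_integral_exp hG hG2, ← mul_assoc, ← mul_assoc]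
  congr 1
  have h2 : ‖((2 * Real.pi)⁻¹ : ℂ)‖ₑ = ENNReal.ofReal ((2 * Real.pi)⁻¹) := by
    rw [← ofReal_norm]
    congr 1
    rw [norm_inv, norm_mul, Complex.norm_real, Real.norm_eq_abs, abs_of_pos Real.pi_pos]
    simp
  rw [h2, ENNReal.ofReal_rpow_of_pos (by positivity : (0 : ℝ) < 2 * Real.pi), transformConst]
  simp only [inv_neg, inv_one, abs_neg, abs_one, ENNReal.ofReal_one, ENNReal.one_rpow, mul_one]
  rw [← ENNReal.ofReal_mul (by positivity)]
  rfl

lemma memLp_two_of_decay {h : ℂ → ℂ} (hc : ContinuousOn h {z | 0 ≤ z.im}) {K : ℝ} (hK : 0 ≤ K)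
    (hb : ∀ z : ℂ, 0 ≤ z.im → ‖h z‖ ≤ K / (1 + ‖z‖ ^ 2)) :
    MemLp (fun x : ℝ => h x) 2 volume := by
  have hint := integrable_of_decay hc hb
  refine (memLp_two_iff_integrable_sq_norm hint.aestronglyMeasurable).2 ?_
  refine (hint.norm.const_mul K).mono' (hint.aestronglyMeasurable.norm.pow 2)
    (Eventually.of_forall fun x => ?_)
  rw [Real.norm_eq_abs, abs_of_nonneg (by positivity), pow_two]
  gcongr
  exact (hb x (by simp)).trans (div_le_self hK (by nlinarith [sq_nonneg ‖(x : ℂ)‖]))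

/-- The boundary transform of a function with quadratic decay is in `L²`, with norm controlled by
the boundary values. -/
lemma memLp_boundaryTransform_of_decay {G : ℂ → ℂ} (hc : ContinuousOn G {z | 0 ≤ z.im}) {R C : ℝ}
    (hb : ∀ z : ℂ, 0 ≤ z.im → R ≤ ‖z‖ → ‖G z‖ ≤ C / ‖z‖ ^ 2) {D : ℝ≥0}
    (hD : eLpNorm (fun x : ℝ => G x) 2 volume ≤ D) :
    MemLp (boundaryTransform G) 2 volume ∧
      eLpNorm (boundaryTransform G) 2 volume ≤ (transformConst * D : ℝ≥0) := by
  obtain ⟨K, hK, hbK⟩ := exists_bound_of_decay hc hb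
  have hint := integrable_of_decay hc hbK
  have hle : eLpNorm (boundaryTransform G) 2 volume ≤ (transformConst * D : ℝ≥0) := by
    rw [eLpNorm_boundaryTransform hint (memLp_two_of_decay hc hK hbK), ENNReal.coe_mul]
    gcongr
  refine ⟨⟨?_, hle.trans_lt ENNReal.coe_lt_top⟩, hle⟩
  refine (Continuous.aestronglyMeasurable ?_).const_mul _
  refine continuous_of_dominated (bound := fun x : ℝ => ‖G x‖) (fun t => ?_) (fun t => ?_)
    hint.norm (Eventually.of_forall fun x => by fun_prop)
  · exact (Continuous.aestronglyMeasurable (by fun_prop)).mul hint.aestronglyMeasurable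
  · refine Eventually.of_forall fun x => ?_
    rw [norm_mul, Complex.norm_exp]
    simp

/-! ### The Paley–Wiener theorem for the Hardy space -/

lemma norm_exp_I_mul (z : ℂ) (t : ℝ) :
    ‖Complex.exp (Complex.I * z * t)‖ = Real.exp (-(z.im * t)) := by
  rw [Complex.norm_exp]
  simp

lemma memLp_exp_I_mul {z : ℂ} (hz : 0 < z.im) :
    MemLp (fun t : ℝ => Complex.exp (Complex.I * z * t)) 2 (volume.restrict (Set.Ioi 0)) := by
  refine (memLp_two_iff_integrable_sq_norm (Continuous.aestronglyMeasurable (by fun_prop))).2 ?_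
  have h : IntegrableOn (fun t : ℝ => Real.exp (-(2 * z.im) * t)) (Set.Ioi 0) :=
    exp_neg_integrableOn_Ioi 0 (by positivity)
  refine h.congr (Eventually.of_forall fun t => ?_)
  simp only [norm_exp_I_mul]
  rw [← Real.exp_nat_mul]
  congr 1
  push_cast
  ring

/-- Plancherel's theorem for Fourier integrals over a subset of the line. -/
lemma eLpNorm_setIntegral_exp {s : Set ℝ} (hs : MeasurableSet s) {w : ℝ → ℂ}
    (hw : IntegrableOn w s) (hw2 : MemLp w 2 (volume.restrict s)) :
    eLpNorm (fun x : ℝ => ∫ t in s, Complex.exp (Complex.I * x * t) * w t) 2 volume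
      = ENNReal.ofReal (2 * Real.pi) ^ (1 / 2 : ℝ) * eLpNorm w 2 (volume.restrict s) := by
  have h := eLpNorm_integral_exp ((integrable_indicator_iff hs).2 hw)
    ((memLp_indicator_iff_restrict hs).2 hw2)
  rw [eLpNorm_indicator_eq_eLpNorm_restrict hs] at h
  rw [← h]
  congr 1
  ext x
  rw [← integral_indicator hs]
  congr 1
  ext t
  by_cases ht : t ∈ s <;> simp [ht]

/-- The Fourier–Laplace transform maps `L²(0, ∞)` into `H²`. -/
lemma hardyUpper_integral_exp {v : ℝ → ℂ} (hv : MemLp v 2 (volume.restrict (Set.Ioi 0))) :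
    (fun z => ∫ t in Set.Ioi (0 : ℝ), Complex.exp (Complex.I * z * t) * v t) ∈ HardyUpper 2 := by
  have hint : ∀ z : ℂ, 0 < z.im →
      Integrable (fun t : ℝ => Complex.exp (Complex.I * z * t) * v t)
        (volume.restrict (Set.Ioi 0)) :=
    fun z hz => (memLp_exp_I_mul hz).integrable_mul hv
  refine ⟨?_, ?_⟩
  · refine differentiableOn_integral (isOpen_lt continuous_const Complex.continuous_im)
      (fun z hz => (hint z hz).aestronglyMeasurable) (fun t => by fun_prop) fun z hz => ?_
    have hz0 : 0 < z.im := hz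
    set y : ℂ := (z.im / 2 : ℝ) * Complex.I
    have hy : y.im = z.im / 2 := by simp [y]
    refine ⟨{w | z.im / 2 < w.im},
      (isOpen_lt continuous_const Complex.continuous_im).mem_nhds (half_lt_self hz0),
      _, (hint y (by rw [hy]; linarith)).norm, ?_⟩
    refine (ae_restrict_iff' measurableSet_Ioi).2 (Eventually.of_forall fun t ht w hw => ?_)
    rw [norm_mul, norm_mul, norm_exp_I_mul, norm_exp_I_mul, hy]
    have ht0 : 0 < t := ht
    have hw' : z.im / 2 < w.im := hw
    gcongr
  · refine ⟨(ENNReal.ofReal (2 * Real.pi) ^ (1 / 2 : ℝ) *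
      eLpNorm v 2 (volume.restrict (Set.Ioi 0))).toNNReal, fun y hy => ?_⟩
    rw [ENNReal.coe_toNNReal (ENNReal.mul_ne_top
      (ENNReal.rpow_ne_top_of_nonneg (by norm_num) ENNReal.ofReal_ne_top) hv.2.ne)]
    set w : ℝ → ℂ := fun t => Complex.exp (Complex.I * (y * Complex.I) * t) * v t
    have hyI : ((y : ℂ) * Complex.I).im = y := by simp
    have hwint : IntegrableOn w (Set.Ioi 0) := hint _ (by rw [hyI]; exact hy)
    have hwv : ∀ᵐ t ∂volume.restrict (Set.Ioi (0 : ℝ)), ‖w t‖ ≤ ‖v t‖ := by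
      refine (ae_restrict_iff' measurableSet_Ioi).2 (Eventually.of_forall fun t ht => ?_)
      rw [norm_mul, norm_exp_I_mul, hyI]
      exact mul_le_of_le_one_left (norm_nonneg _)
        (Real.exp_le_one_iff.2 (neg_nonpos.2 (mul_pos hy ht).le))
    have hw2 : MemLp w 2 (volume.restrict (Set.Ioi 0)) := hv.of_le hwint.aestronglyMeasurable hwv
    have h1 := eLpNorm_setIntegral_exp measurableSet_Ioi hwint hw2
    have h2 : (fun x : ℝ => ∫ t in Set.Ioi (0 : ℝ),
        Complex.exp (Complex.I * (x + y * Complex.I) * t) * v t)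
        = fun x : ℝ => ∫ t in Set.Ioi (0 : ℝ), Complex.exp (Complex.I * x * t) * w t := by
      ext x
      congr 1
      ext t
      rw [← mul_assoc, ← Complex.exp_add]
      ring_nf
    rw [h2, h1]
    gcongr
    exact eLpNorm_mono_ae hwv

/-- Every function in `H²` is the Fourier–Laplace transform of a function in `L²(0, ∞)`.
Averaging over short segments makes the function bounded on half-planes, and a shift together with
a rational factor yields quadratic decay; the representing functions of these approximants are
bounded in `L²` and a weak limit represents the given function. -/
lemma exists_integral_exp_of_hardyUpper {F : ℂ → ℂ} (hF : F ∈ HardyUpper 2) :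
    ∃ v : ℝ → ℂ, MemLp v 2 (volume.restrict (Set.Ioi 0)) ∧ ∀ z : ℂ, 0 < z.im →
      ∫ t in Set.Ioi (0 : ℝ), Complex.exp (Complex.I * z * t) * v t = F z := by
  obtain ⟨hd, D, hD⟩ := hF
  set U : Set ℂ := {z | 0 < z.im}
  have hU : IsOpen U := isOpen_lt continuous_const Complex.continuous_im
  have hUtr : ∀ z ∈ U, ∀ x : ℝ, z + x ∈ U := fun z hz x => by simpa [U] using hz
  have hline : ∀ y : ℝ, 0 < y → Continuous fun x : ℝ => F (x + y * Complex.I) := fun y hy =>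
    hd.continuousOn.comp_continuous (by fun_prop) fun x => by simpa [U] using hy
  have hmean : ∀ (h x y : ℝ), segmentMean h F (x + y * Complex.I)
      = ∫ s in Set.Ioc (0 : ℝ) 1, F (((x + h * s : ℝ) : ℂ) + y * Complex.I) := by
    intro h x y
    unfold segmentMean
    congr 1
    ext s
    congr 1
    push_cast
    ring
  -- `h j` serves as the length of the segment, the height of the shift, and the parameter of the
  -- rational factor
  set h : ℕ → ℝ := fun j => 1 / ((j : ℝ) + 1)
  have hpos : ∀ j, 0 < h j := fun j => by positivity
  have hle : ∀ j, h j ≤ 1 := fun j => by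
    rw [div_le_one (by positivity)]; linarith [j.cast_nonneg (α := ℝ)]
  have hlim : Tendsto h atTop (𝓝 0) := tendsto_one_div_add_atTop_nhds_zero_nat
  set G : ℕ → ℂ → ℂ := fun j z =>
    segmentMean (h j) F (z + h j * Complex.I) / (1 - Complex.I * h j * z) ^ 2
  have hden : ∀ j z, -h j < z.im → 1 - Complex.I * h j * z ≠ 0 := by
    intro j z hz h0
    have := congrArg Complex.re h0
    simp at this
    nlinarith [hpos j, hle j]
  have hGd : ∀ j, DifferentiableOn ℂ (G j) {z | -h j < z.im} := by
    intro j
    refine DifferentiableOn.div ?_ (by fun_prop) fun z hz => pow_ne_zero 2 (hden j z hz)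
    refine (differentiableOn_segmentMean hU hUtr hd (h j)).comp (by fun_prop) fun z hz => ?_
    simp only [Set.mem_ofPred_eq] at hz
    simp [U]; linarith
  have hdenb : ∀ j (z : ℂ), 0 ≤ z.im →
      1 ≤ ‖1 - Complex.I * h j * z‖ ∧ h j * ‖z‖ ≤ ‖1 - Complex.I * h j * z‖ := by
    intro j z hz
    have e : ‖1 - Complex.I * h j * z‖ ^ 2 = (1 + h j * z.im) ^ 2 + (h j * z.re) ^ 2 := by
      rw [← Complex.normSq_eq_norm_sq, Complex.normSq_apply]; simp; ring
    have e2 : ‖z‖ ^ 2 = z.re ^ 2 + z.im ^ 2 := by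
      rw [← Complex.normSq_eq_norm_sq, Complex.normSq_apply]; ring
    have := mul_nonneg (hpos j).le hz
    constructor
    · refine le_of_sq_le_sq ?_ (norm_nonneg _)
      rw [e]; nlinarith [sq_nonneg (h j * z.re)]
    · refine le_of_sq_le_sq ?_ (norm_nonneg _)
      rw [e, mul_pow, e2]; nlinarith
  have hmeanb : ∀ j, ∃ B : ℝ, 0 ≤ B ∧ ∀ z ∈ U, ‖segmentMean (h j) F z‖ ≤ B := by
    intro j
    refine ⟨(ENNReal.ofReal |(h j)⁻¹| ^ (1 / 2 : ℝ) * D).toReal, ENNReal.toReal_nonneg,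
      fun z hz => ?_⟩
    have h1 := enorm_integral_comp_segment_le (hline z.im hz) (hpos j).ne' z.re
    rw [← hmean, Complex.re_add_im] at h1
    rw [← toReal_enorm]
    refine ENNReal.toReal_mono (ENNReal.mul_ne_top
      (ENNReal.rpow_ne_top_of_nonneg (by norm_num) ENNReal.ofReal_ne_top) ENNReal.coe_ne_top)
      (h1.trans ?_)
    gcongr
    exact hD _ hz
  have hup : ∀ j z, 0 ≤ z.im → z + h j * Complex.I ∈ U := fun j z hz => by
    have := hpos j
    simp [U]; linarith
  have hGb : ∀ j, ∃ C, ∀ z : ℂ, 0 ≤ z.im → (1 : ℝ) ≤ ‖z‖ → ‖G j z‖ ≤ C / ‖z‖ ^ 2 := by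
    intro j
    obtain ⟨B, hB, hBz⟩ := hmeanb j
    refine ⟨B / h j ^ 2, fun z hz hz1 => ?_⟩
    rw [norm_div, norm_pow, div_div, ← mul_pow]
    have := hpos j
    refine div_le_div₀ hB (hBz _ (hup j z hz)) (by positivity) ?_
    gcongr
    exact (hdenb j z hz).2
  have hGn : ∀ j, eLpNorm (fun x : ℝ => G j x) 2 volume ≤ D := by
    intro j
    refine le_trans ?_ ((eLpNorm_integral_comp_segment_le (hline (h j) (hpos j)) (h j)).trans
      (hD _ (hpos j)))
    refine eLpNorm_mono fun x => ?_
    rw [← hmean, norm_div, norm_pow]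
    exact div_le_self (norm_nonneg _) (one_le_pow₀ (hdenb j x (by simp)).1)
  have hc : ∀ j, ContinuousOn (G j) {z | 0 ≤ z.im} := fun j =>
    (hGd j).continuousOn.mono fun z hz => by
      have := hpos j
      simp only [Set.mem_ofPred_eq] at hz ⊢; linarith
  choose C hCb using hGb
  have hT := fun j => memLp_boundaryTransform_of_decay (hc j) (hCb j) (hGn j)
  obtain ⟨v, hv, hlimv⟩ := exists_weak_limit
    (fun j => (hT j).1.mono_measure (Measure.restrict_le_self (s := Set.Ioi 0)))
    (fun j => (eLpNorm_restrict_le _ _ _ _).trans (hT j).2)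
  refine ⟨v, hv, fun z hz => hlimv _ (memLp_exp_I_mul hz) _ ?_⟩
  have hrep : ∀ j, ∫ t in Set.Ioi (0 : ℝ),
      Complex.exp (Complex.I * z * t) * boundaryTransform (G j) t = G j z := fun j =>
    eq_integral_exp_of_decay (hpos j) (hGd j) (hCb j) hz
  simp_rw [hrep]
  have hlimC : Tendsto (fun j => (h j : ℂ)) atTop (𝓝 0) :=
    (Complex.continuous_ofReal.tendsto' 0 0 rfl).comp hlim
  have l1 : Tendsto (fun j => segmentMean (h j) F (z + h j * Complex.I)) atTop (𝓝 (F z)) := by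
    refine tendsto_segmentMean hU hUtr hd.continuousOn hz ?_ hlim
    simpa using (hlimC.mul_const Complex.I).const_add z
  have l2 : Tendsto (fun j => (1 - Complex.I * h j * z) ^ 2) atTop (𝓝 1) := by
    simpa using (((hlimC.const_mul Complex.I).mul_const z).const_sub 1).pow 2
  have l3 := l1.div l2 one_ne_zero
  rw [div_one] at l3
  exact l3

/-! ### The Paley–Wiener theorem for entire functions -/

/-- The bound in the closed upper half-plane: the Phragmén–Lindelöf principle is applied to
`f (i w) exp (-(σ + ε) w)` in the right half-plane, and `ε` tends to zero. -/
lemma norm_le_mul_exp_of_im_nonneg {f : ℂ → ℂ} {σ : ℝ} (hd : Differentiable ℂ f)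
    (hexp : ExpTypeAtMost σ f) {B : ℝ} (hB : ∀ x : ℝ, ‖f x‖ ≤ B) {z : ℂ} (hz : 0 ≤ z.im) :
    ‖f z‖ ≤ B * Real.exp (σ * z.im) := by
  have key : ∀ ε > 0, ‖f z‖ ≤ B * Real.exp ((σ + ε) * z.im) := by
    intro ε hε
    obtain ⟨C, hC⟩ := hexp ε hε
    have hC0 : 0 ≤ C := by
      have := (norm_nonneg _).trans (hC 0)
      simpa using this
    set g : ℂ → ℂ := fun w => f (Complex.I * w) * Complex.exp (-((σ + ε : ℝ) * w))
    have hg : Differentiable ℂ g := by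
      have : Differentiable ℂ fun w : ℂ => f (Complex.I * w) := hd.comp (by fun_prop)
      fun_prop
    have hnorm : ∀ w : ℂ, ‖g w‖ = ‖f (Complex.I * w)‖ * Real.exp (-((σ + ε) * w.re)) := by
      intro w
      rw [norm_mul, Complex.norm_exp]
      simp
    have hIw : ∀ w : ℂ, ‖Complex.I * w‖ = ‖w‖ := fun w => by simp
    have h1 := PhragmenLindelof.right_half_plane_of_bounded_on_real (f := g) (C := B)
      (z := -Complex.I * z) hg.diffContOnCl ?_ ?_ ?_ (by simpa using hz)
    · rw [hnorm, ← mul_assoc] at h1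
      simp only [mul_neg, Complex.I_mul_I, neg_neg, one_mul, Complex.neg_re, Complex.mul_re,
        Complex.I_re, Complex.I_im, zero_mul, zero_sub, neg_mul] at h1
      rw [Real.exp_neg, ← div_eq_mul_inv, div_le_iff₀ (Real.exp_pos _)] at h1
      exact h1
    · refine ⟨1, by norm_num, 2 * |σ + ε|, Asymptotics.IsBigO.of_bound C ?_⟩
      refine Eventually.of_forall fun w => ?_
      rw [hnorm, Real.rpow_one, Real.norm_eq_abs, Real.abs_exp]
      calc ‖f (Complex.I * w)‖ * Real.exp (-((σ + ε) * w.re))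
          ≤ C * Real.exp ((σ + ε) * ‖w‖) * Real.exp (|σ + ε| * ‖w‖) := by
            gcongr
            · simpa only [hIw] using hC (Complex.I * w)
            · refine (neg_le_abs _).trans ?_
              rw [abs_mul]
              gcongr
              exact Complex.abs_re_le_norm w
        _ ≤ C * Real.exp (2 * |σ + ε| * ‖w‖) := by
            rw [mul_assoc, ← Real.exp_add]
            gcongr
            nlinarith [mul_le_mul_of_nonneg_right (le_abs_self (σ + ε)) (norm_nonneg w)]
    · refine isBoundedUnder_of_eventually_le (a := C) ?_
      filter_upwards [eventually_ge_atTop 0] with x hx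
      rw [hnorm]
      have := hC (Complex.I * x)
      rw [hIw, Complex.norm_real, Real.norm_eq_abs, abs_of_nonneg hx] at this
      rw [Complex.ofReal_re, Real.exp_neg, ← div_eq_mul_inv, div_le_iff₀ (Real.exp_pos _)]
      exact this
    · intro x
      rw [hnorm]
      have : Complex.I * (x * Complex.I) = ((-x : ℝ) : ℂ) := by
        push_cast
        linear_combination (x : ℂ) * Complex.I_mul_I
      rw [this]
      simpa using hB (-x)
  have hlim : Tendsto (fun ε : ℝ => B * Real.exp ((σ + ε) * z.im)) (𝓝[>] 0)
      (𝓝 (B * Real.exp (σ * z.im))) := by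
    have : Continuous fun ε : ℝ => B * Real.exp ((σ + ε) * z.im) := by fun_prop
    simpa using (this.tendsto 0).mono_left nhdsWithin_le_nhds
  exact ge_of_tendsto hlim (eventually_mem_nhdsWithin.mono fun ε hε => key ε hε)

/-- **Phragmén–Lindelöf**: a function of exponential type `σ` bounded on the real line grows at
most like `exp (σ |Im z|)`. -/
lemma norm_le_mul_exp_abs_im {f : ℂ → ℂ} {σ : ℝ} (hd : Differentiable ℂ f)
    (hexp : ExpTypeAtMost σ f) {B : ℝ} (hB : ∀ x : ℝ, ‖f x‖ ≤ B) (z : ℂ) :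
    ‖f z‖ ≤ B * Real.exp (σ * |z.im|) := by
  rcases le_total 0 z.im with hz | hz
  · rw [abs_of_nonneg hz]
    exact norm_le_mul_exp_of_im_nonneg hd hexp hB hz
  · rw [abs_of_nonpos hz]
    have h := norm_le_mul_exp_of_im_nonneg (f := fun w => f (-w)) (σ := σ) (B := B) (z := -z)
      (hd.comp differentiable_neg) (fun ε hε => ?_) (fun x => ?_) (by simpa using hz)
    · simpa using h
    · obtain ⟨C, hC⟩ := hexp ε hε
      exact ⟨C, fun w => by simpa using hC (-w)⟩
    · simpa using hB (-x)

/-- The entire function `sin z / z`. -/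
def complexSinc : ℂ → ℂ := dslope Complex.sin 0

lemma differentiable_complexSinc : Differentiable ℂ complexSinc := by
  rw [← differentiableOn_univ]
  exact (Complex.differentiableOn_dslope univ_mem).2 Complex.differentiable_sin.differentiableOn

lemma complexSinc_zero : complexSinc 0 = 1 := by
  simp [complexSinc, dslope_same]

lemma complexSinc_of_ne {z : ℂ} (hz : z ≠ 0) : complexSinc z = Complex.sin z / z := by
  simp [complexSinc, dslope_of_ne _ hz, slope_def_field]

lemma norm_sin_le (z : ℂ) : ‖Complex.sin z‖ ≤ Real.exp |z.im| := by
  have h1 : ‖Complex.exp (-z * Complex.I)‖ ≤ Real.exp |z.im| := by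
    rw [Complex.norm_exp]
    simpa using le_abs_self z.im
  have h2 : ‖Complex.exp (z * Complex.I)‖ ≤ Real.exp |z.im| := by
    rw [Complex.norm_exp]
    simpa using neg_le_abs z.im
  rw [Complex.sin, norm_div, norm_mul, Complex.norm_I, mul_one, Complex.norm_ofNat]
  linarith [norm_sub_le (Complex.exp (-z * Complex.I)) (Complex.exp (z * Complex.I))]

lemma norm_complexSinc_le {z : ℂ} (hz : z ≠ 0) : ‖complexSinc z‖ ≤ Real.exp |z.im| / ‖z‖ := by
  rw [complexSinc_of_ne hz, norm_div]
  gcongr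
  exact norm_sin_le z

lemma norm_complexSinc_ofReal_le (x : ℝ) : ‖complexSinc x‖ ≤ 1 := by
  rcases eq_or_ne x 0 with rfl | hx
  · simp [complexSinc_zero]
  · rw [complexSinc_of_ne (by exact_mod_cast hx), ← Complex.ofReal_sin, norm_div,
      Complex.norm_real, Complex.norm_real, Real.norm_eq_abs, Real.norm_eq_abs,
      div_le_one (abs_pos.2 hx)]
    exact Real.abs_sin_le_abs

lemma expTypeAtMost_segmentMean {f : ℂ → ℂ} {σ : ℝ} (hσ : 0 ≤ σ) (hexp : ExpTypeAtMost σ f)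
    {h : ℝ} (hh : 0 ≤ h) : ExpTypeAtMost σ (segmentMean h f) := by
  intro ε hε
  obtain ⟨C, hC⟩ := hexp ε hε
  have hC0 : 0 ≤ C := by
    have := (norm_nonneg _).trans (hC 0)
    simpa using this
  refine ⟨C * Real.exp ((σ + ε) * h), fun z => ?_⟩
  refine (norm_setIntegral_le_of_norm_le_const (C := C * Real.exp ((σ + ε) * (‖z‖ + h)))
    (by simp) fun s hs => ?_).trans (le_of_eq ?_)
  · refine (hC _).trans ?_
    have h1 : ‖z + (h * s : ℝ)‖ ≤ ‖z‖ + h := by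
      refine (norm_add_le _ _).trans ?_
      rw [Complex.norm_real, Real.norm_eq_abs, abs_mul, abs_of_nonneg hh, abs_of_pos hs.1]
      gcongr
      exact mul_le_of_le_one_right hh hs.2
    gcongr
  · simp only [Real.volume_real_Ioc, sub_zero, zero_le_one, sup_of_le_left, mul_one]
    rw [mul_assoc, ← Real.exp_add]
    ring_nf

/-- If `G` grows at most like `exp (a |Im z|) / |z|²` in the lower half-plane, then its Fourier
transform vanishes beyond `a`. -/
lemma boundaryTransform_eq_zero {G : ℂ → ℂ} (hd : Differentiable ℂ G) {a C : ℝ} (hC0 : 0 ≤ C)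
    (hG : ∀ z : ℂ, z.im ≤ 0 → 1 ≤ ‖z‖ → ‖G z‖ ≤ C * Real.exp (a * -z.im) / ‖z‖ ^ 2)
    {t : ℝ} (ht : a ≤ t) : boundaryTransform G t = 0 := by
  -- the reflection `w ↦ -w` carries the lower half-plane to the upper one
  set h : ℂ → ℂ := fun w => Complex.exp (Complex.I * w * t) * G (-w)
  have hh : Differentiable ℂ h := by
    have : Differentiable ℂ fun w : ℂ => G (-w) := hd.comp differentiable_neg
    fun_prop
  have h0 : ∫ x : ℝ, h x = 0 := by
    refine integral_eq_zero_of_decay hh.continuous.continuousOn hh.differentiableOn (R := 1)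
      (C := C) fun z hz hz1 => ?_
    have h1 := hG (-z) (by simpa using hz) (by simpa using hz1)
    rw [Complex.neg_im, neg_neg, norm_neg] at h1
    rw [norm_mul, norm_exp_I_mul]
    calc Real.exp (-(z.im * t)) * ‖G (-z)‖
        ≤ Real.exp (-(z.im * t)) * (C * Real.exp (a * z.im) / ‖z‖ ^ 2) := by gcongr
      _ = C * Real.exp (-(z.im * (t - a))) / ‖z‖ ^ 2 := by
          rw [← mul_div_assoc, mul_left_comm, ← Real.exp_add]
          ring_nf
      _ ≤ C / ‖z‖ ^ 2 := by
          gcongr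
          refine mul_le_of_le_one_right hC0 (Real.exp_le_one_iff.2 (neg_nonpos.2 ?_))
          exact mul_nonneg hz (by linarith)
  have h1 : ∫ x : ℝ, Complex.exp (Complex.I * (-t : ℝ) * x) * G x = ∫ x : ℝ, h x := by
    rw [← integral_neg_eq_self]
    congr 1
    ext x
    simp only [h]
    push_cast
    congr 2
    ring
  rw [boundaryTransform, h1, h0, mul_zero]

/-- Every function in the Paley–Wiener space is, up to the factor `exp (-i σ z)`, the Fourier
transform of a function in `L²(0, 2σ)`. The function is averaged over short segments, which makes
it bounded on the line, contracted, and multiplied by a squared sinc function whose type makes up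
for the contraction; a weak limit of the transforms of these approximants is the required
function. -/
lemma exists_integral_exp_of_paleyWiener {f : ℂ → ℂ} {σ : ℝ} (hσ : 0 < σ)
    (hf : f ∈ PaleyWiener 2 σ) :
    ∃ v : ℝ → ℂ, MemLp v 2 (volume.restrict (Set.Ioo 0 (2 * σ))) ∧ ∀ z : ℂ, 0 < z.im →
      ∫ t in Set.Ioo (0 : ℝ) (2 * σ), Complex.exp (Complex.I * z * t) * v t
        = Complex.exp (Complex.I * σ * z) * f z := by
  obtain ⟨hd, hexp, hL2⟩ := hf
  set D : ℝ≥0 := (eLpNorm (fun x : ℝ => f x) 2 volume).toNNReal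
  have hD : eLpNorm (fun x : ℝ => f x) 2 volume = D := (ENNReal.coe_toNNReal hL2.2.ne).symm
  have hfc : Continuous fun x : ℝ => f x := hd.continuous.comp Complex.continuous_ofReal
  have hmean : ∀ h x : ℝ, segmentMean h f x
      = ∫ s in Set.Ioc (0 : ℝ) 1, f ((x + h * s : ℝ) : ℂ) := by
    intro h x
    simp [segmentMean]
  -- `h j ≤ 1 / 2` keeps the contraction factor `1 - h j` away from zero
  set h : ℕ → ℝ := fun j => 1 / ((j : ℝ) + 1) / 2
  have hpos : ∀ j, 0 < h j := fun j => by positivity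
  have hle : ∀ j, h j ≤ 1 / 2 := fun j => by
    have : 1 / ((j : ℝ) + 1) ≤ 1 := by
      rw [div_le_one (by positivity)]; linarith [j.cast_nonneg (α := ℝ)]
    simp only [h]; linarith
  have hlim : Tendsto h atTop (𝓝 0) := by
    have := (tendsto_one_div_add_atTop_nhds_zero_nat (𝕜 := ℝ)).div_const 2
    rwa [zero_div] at this
  set m : ℕ → ℂ → ℂ := fun j => segmentMean (h j) f
  have hmd : ∀ j, Differentiable ℂ (m j) := fun j => differentiableOn_univ.1
    (differentiableOn_segmentMean isOpen_univ (fun _ _ _ => trivial) hd.differentiableOn (h j))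
  have hmb : ∀ j, ∃ B : ℝ, 0 ≤ B ∧ ∀ x : ℝ, ‖m j x‖ ≤ B := by
    intro j
    have hfin : ENNReal.ofReal |(h j)⁻¹| ^ (1 / 2 : ℝ) * eLpNorm (fun x : ℝ => f x) 2 volume ≠ ⊤ :=
      ENNReal.mul_ne_top
        (ENNReal.rpow_ne_top_of_nonneg (by norm_num) ENNReal.ofReal_ne_top) hL2.2.ne
    refine ⟨(ENNReal.ofReal |(h j)⁻¹| ^ (1 / 2 : ℝ) *
      eLpNorm (fun x : ℝ => f x) 2 volume).toReal, ENNReal.toReal_nonneg, fun x => ?_⟩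
    have h1 := enorm_integral_comp_segment_le hfc (hpos j).ne' x
    rw [← hmean] at h1
    rw [← toReal_enorm]
    exact ENNReal.toReal_mono hfin h1
  choose B hB0 hB using hmb
  have hmB : ∀ j z, ‖m j z‖ ≤ B j * Real.exp (σ * |z.im|) := fun j z =>
    norm_le_mul_exp_abs_im (hmd j) (expTypeAtMost_segmentMean hσ.le hexp (hpos j).le) (hB j) z
  -- contraction by `1 - h j`, and a squared sinc function of type `h j * σ`
  set κ : ℕ → ℝ := fun j => h j * σ / 2
  have hκ : ∀ j, 0 < κ j := fun j => by have := hpos j; positivity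
  set G : ℕ → ℂ → ℂ := fun j z =>
    Complex.exp (Complex.I * σ * z) * (m j ((1 - h j : ℝ) * z) * complexSinc (κ j * z) ^ 2)
  have hGd : ∀ j, Differentiable ℂ (G j) := by
    intro j
    have h1 : Differentiable ℂ fun z : ℂ => m j ((1 - h j : ℝ) * z) :=
      (hmd j).comp (by fun_prop)
    have h2 : Differentiable ℂ fun z : ℂ => complexSinc (κ j * z) :=
      differentiable_complexSinc.comp (by fun_prop)
    fun_prop
  have hGb : ∀ j z, 1 ≤ ‖z‖ →
      ‖G j z‖ ≤ (B j / κ j ^ 2) * Real.exp (σ * |z.im| - σ * z.im) / ‖z‖ ^ 2 := by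
    intro j z hz
    have hz0 : z ≠ 0 := norm_pos_iff.1 (by linarith)
    have hκj := hκ j
    have hκz : (κ j : ℂ) * z ≠ 0 := mul_ne_zero (by exact_mod_cast hκj.ne') hz0
    have b1 := hmB j ((1 - h j : ℝ) * z)
    have b2 := norm_complexSinc_le hκz
    have hj1 : 0 ≤ 1 - h j := by linarith [hle j]
    rw [Complex.im_ofReal_mul, abs_mul, abs_of_nonneg hj1] at b1
    rw [Complex.im_ofReal_mul, abs_mul, abs_of_pos hκj, norm_mul, Complex.norm_real,
      Real.norm_eq_abs, abs_of_pos hκj] at b2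
    have b3 : ‖Complex.exp (Complex.I * σ * z)‖ = Real.exp (-(σ * z.im)) := by
      rw [Complex.norm_exp]; simp
    rw [norm_mul, norm_mul, norm_pow, b3]
    have hB0j := hB0 j
    calc Real.exp (-(σ * z.im)) * (‖m j ((1 - h j : ℝ) * z)‖ * ‖complexSinc (κ j * z)‖ ^ 2)
        ≤ Real.exp (-(σ * z.im)) * (B j * Real.exp (σ * ((1 - h j) * |z.im|)) *
          (Real.exp (κ j * |z.im|) / (κ j * ‖z‖)) ^ 2) := by gcongr
      _ = (B j / κ j ^ 2) * (Real.exp (-(σ * z.im)) * (Real.exp (σ * ((1 - h j) * |z.im|)) *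
          Real.exp (κ j * |z.im|) ^ 2)) / ‖z‖ ^ 2 := by
            have : ‖z‖ ≠ 0 := norm_ne_zero_iff.2 hz0
            field_simp
      _ = (B j / κ j ^ 2) * Real.exp (σ * |z.im| - σ * z.im) / ‖z‖ ^ 2 := by
            rw [← Real.exp_nat_mul, ← Real.exp_add, ← Real.exp_add]
            congr 3
            simp only [κ]
            push_cast
            ring
  have hGup : ∀ j (z : ℂ), 0 ≤ z.im → (1 : ℝ) ≤ ‖z‖ → ‖G j z‖ ≤ (B j / κ j ^ 2) / ‖z‖ ^ 2 := by
    intro j z hz hz1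
    have := hGb j z hz1
    rwa [abs_of_nonneg hz, sub_self, Real.exp_zero, mul_one] at this
  have hGn : ∀ j, eLpNorm (fun x : ℝ => G j x) 2 volume ≤ (2 * D : ℝ≥0) := by
    intro j
    have hj : 1 / 2 ≤ 1 - h j := by linarith [hle j]
    have s1 : eLpNorm (fun x : ℝ => G j x) 2 volume
        ≤ eLpNorm (fun x : ℝ => m j ((1 - h j) * x : ℝ)) 2 volume := by
      refine eLpNorm_mono fun x => ?_
      have b3 : ‖Complex.exp (Complex.I * σ * x)‖ = 1 := by
        rw [Complex.norm_exp]; simp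
      have b2 := norm_complexSinc_ofReal_le (κ j * x)
      rw [norm_mul, norm_mul, norm_pow, b3, one_mul, Complex.ofReal_mul]
      rw [Complex.ofReal_mul] at b2
      exact mul_le_of_le_one_right (norm_nonneg _) (pow_le_one₀ (norm_nonneg _) b2)
    refine s1.trans ?_
    rw [eLpNorm_two_comp_mul_left (fun x : ℝ => m j x) (by linarith), ENNReal.coe_mul]
    have s2 : eLpNorm (fun x : ℝ => m j x) 2 volume ≤ D := by
      have := eLpNorm_integral_comp_segment_le hfc (h j)
      simp_rw [← hmean] at this
      rwa [hD] at this
    have s3 : ENNReal.ofReal |(1 - h j)⁻¹| ^ (1 / 2 : ℝ) ≤ (2 : ℝ≥0) := by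
      have e1 : |(1 - h j)⁻¹| ≤ 2 := by
        rw [abs_inv, abs_of_pos (by linarith), inv_le_comm₀ (by linarith) two_pos]
        linarith
      calc ENNReal.ofReal |(1 - h j)⁻¹| ^ (1 / 2 : ℝ) ≤ ENNReal.ofReal 2 ^ (1 / 2 : ℝ) := by gcongr
        _ ≤ ENNReal.ofReal 2 ^ (1 : ℝ) := by
            refine ENNReal.rpow_le_rpow_of_exponent_le ?_ (by norm_num)
            simp
        _ = (2 : ℝ≥0) := by simp
    gcongr
  have hT := fun j => memLp_boundaryTransform_of_decay (hGd j).continuous.continuousOn (hGup j)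
    (hGn j)
  have hT0 : ∀ j t, 2 * σ ≤ t → boundaryTransform (G j) t = 0 := by
    intro j t ht
    have hκj := hκ j
    have hB0j := hB0 j
    refine boundaryTransform_eq_zero (hGd j) (C := B j / κ j ^ 2) (by positivity)
      (fun z hz hz1 => ?_) ht
    have := hGb j z hz1
    rw [abs_of_nonpos hz] at this
    convert this using 4
    ring
  obtain ⟨v, hv, hlimv⟩ := exists_weak_limit
    (fun j => (hT j).1.mono_measure (Measure.restrict_le_self (s := Set.Ioo 0 (2 * σ))))
    (fun j => (eLpNorm_restrict_le _ _ _ _).trans (hT j).2)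
  refine ⟨v, hv, fun z hz => hlimv _ ((memLp_exp_I_mul hz).mono_measure
    (Measure.restrict_mono Set.Ioo_subset_Ioi_self le_rfl)) _ ?_⟩
  have hrep : ∀ j, ∫ t in Set.Ioo (0 : ℝ) (2 * σ),
      Complex.exp (Complex.I * z * t) * boundaryTransform (G j) t = G j z := by
    intro j
    rw [← eq_integral_exp_of_decay one_pos (hGd j).differentiableOn (hGup j) hz]
    refine (setIntegral_eq_of_subset_of_forall_sdiff_eq_zero measurableSet_Ioi
      Set.Ioo_subset_Ioi_self fun t ht => ?_).symm
    have ht' : 2 * σ ≤ t := by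
      by_contra hlt
      exact ht.2 ⟨ht.1, not_le.1 hlt⟩
    rw [hT0 j t ht', mul_zero]
  simp_rw [hrep]
  have hlimC : Tendsto (fun j => (h j : ℂ)) atTop (𝓝 0) :=
    (Complex.continuous_ofReal.tendsto' 0 0 rfl).comp hlim
  have l1 : Tendsto (fun j => m j ((1 - h j : ℝ) * z)) atTop (𝓝 (f z)) := by
    refine tendsto_segmentMean isOpen_univ (fun _ _ _ => trivial) hd.continuous.continuousOn
      (Set.mem_univ z) ?_ hlim
    simpa using (hlimC.const_sub 1).mul_const z
  have l2 : Tendsto (fun j => complexSinc (κ j * z) ^ 2) atTop (𝓝 1) := by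
    have e : Tendsto (fun j => (κ j : ℂ) * z) atTop (𝓝 0) := by
      have := ((hlimC.mul_const (σ : ℂ)).div_const 2).mul_const z
      simpa [κ] using this
    have := ((differentiable_complexSinc.continuous.tendsto 0).comp e).pow 2
    rwa [complexSinc_zero, one_pow] at this
  have l3 := (l1.mul l2).const_mul (Complex.exp (Complex.I * σ * z))
  rw [mul_one] at l3
  exact l3

/-- The Fourier transform of a function in `L²(0, 2σ)`, multiplied by `exp (-i σ z)`, is in the
Paley–Wiener space. -/
lemma paleyWiener_integral_exp {σ : ℝ} {v : ℝ → ℂ}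
    (hv : MemLp v 2 (volume.restrict (Set.Ioo 0 (2 * σ)))) :
    (fun z => Complex.exp (-(Complex.I * σ * z)) *
      ∫ t in Set.Ioo (0 : ℝ) (2 * σ), Complex.exp (Complex.I * z * t) * v t)
      ∈ PaleyWiener 2 σ := by
  have hv1 : IntegrableOn v (Set.Ioo 0 (2 * σ)) := hv.integrable one_le_two
  have hmeas : ∀ z : ℂ, AEStronglyMeasurable (fun t : ℝ => Complex.exp (Complex.I * z * t) * v t)
      (volume.restrict (Set.Ioo 0 (2 * σ))) := fun z =>
    (Continuous.aestronglyMeasurable (by fun_prop)).mul hv1.aestronglyMeasurable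
  have hd : Differentiable ℂ fun z : ℂ =>
      ∫ t in Set.Ioo (0 : ℝ) (2 * σ), Complex.exp (Complex.I * z * t) * v t := by
    refine differentiableOn_univ.1 (differentiableOn_integral isOpen_univ (fun z _ => hmeas z)
      (fun t => by fun_prop) fun z _ => ⟨Metric.ball z 1, Metric.ball_mem_nhds z one_pos, _,
        hv1.norm.const_mul (Real.exp ((‖z‖ + 1) * (2 * σ))), ?_⟩)
    refine (ae_restrict_iff' measurableSet_Ioo).2 (Eventually.of_forall fun t ht w hw => ?_)
    rw [norm_mul, norm_exp_I_mul]
    gcongr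
    rw [← neg_mul]
    have h1 : -w.im ≤ ‖w‖ := (neg_le_abs _).trans (Complex.abs_im_le_norm w)
    have h2 : ‖w‖ ≤ ‖z‖ + 1 := by
      have := norm_sub_norm_le w z
      rw [Metric.mem_ball, dist_eq_norm] at hw
      linarith
    have h3 : 0 ≤ ‖z‖ + 1 := by positivity
    have ht0 := ht.1
    have ht1 := ht.2.le
    calc -w.im * t ≤ (‖z‖ + 1) * t := by gcongr; linarith
      _ ≤ (‖z‖ + 1) * (2 * σ) := by gcongr
  have hdiff : Differentiable ℂ fun z : ℂ => Complex.exp (-(Complex.I * σ * z)) *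
      ∫ t in Set.Ioo (0 : ℝ) (2 * σ), Complex.exp (Complex.I * z * t) * v t := by fun_prop
  refine ⟨hdiff, fun ε hε => ⟨∫ t in Set.Ioo (0 : ℝ) (2 * σ), ‖v t‖, fun z => ?_⟩, ?_, ?_⟩
  · beta_reduce
    rw [← integral_const_mul, ← integral_mul_const]
    refine norm_integral_le_of_norm_le (hv1.norm.mul_const _) ?_
    refine (ae_restrict_iff' measurableSet_Ioo).2 (Eventually.of_forall fun t ht => ?_)
    have e1 : ‖Complex.exp (-(Complex.I * σ * z))‖ = Real.exp (σ * z.im) := by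
      rw [Complex.norm_exp]; simp
    rw [norm_mul, norm_mul, norm_exp_I_mul, e1, ← mul_assoc, ← Real.exp_add, mul_comm]
    gcongr
    have h1 : |σ - t| ≤ σ := abs_le.2 ⟨by linarith [ht.2], by linarith [ht.1]⟩
    have hσ0 : 0 ≤ σ := (abs_nonneg _).trans h1
    calc σ * z.im + -(z.im * t) = (σ - t) * z.im := by ring
      _ ≤ |σ - t| * |z.im| := by rw [← abs_mul]; exact le_abs_self _
      _ ≤ σ * ‖z‖ := by gcongr; exact Complex.abs_im_le_norm z
      _ ≤ (σ + ε) * ‖z‖ := by gcongr; linarith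
  · exact (hdiff.continuous.comp Complex.continuous_ofReal).aestronglyMeasurable
  · have h1 := eLpNorm_setIntegral_exp measurableSet_Ioo hv1 hv
    refine lt_of_eq_of_lt ?_ (h1.trans_lt (ENNReal.mul_lt_top
      (ENNReal.rpow_lt_top_of_nonneg (by norm_num) ENNReal.ofReal_ne_top) hv.2))
    refine eLpNorm_congr_norm_ae (Eventually.of_forall fun x => ?_)
    rw [norm_mul, Complex.norm_exp]
    simp

/-! ### The semigroup in the Riesz basis -/

section Diagonal

variable {H : Type*} [NormedAddCommGroup H] [InnerProductSpace ℂ H] {S : ℝ → H →L[ℂ] H}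

lemma IsC0Semigroup.continuousOn (hS : IsC0Semigroup S) {M : ℝ} (hM : ∀ t, 0 ≤ t → ‖S t‖ ≤ M)
    (x : H) : ContinuousOn (fun t => S t x) (Set.Ici 0) := by
  have hzero : Tendsto (fun t => S t x) (𝓝[≥] 0) (𝓝 x) := by
    have h := hS.tendsto_zero x
    have h0 : S 0 x = x := by rw [hS.map_zero]; rfl
    have h1 : ContinuousWithinAt (fun t => S t x) (Set.Ioi 0) 0 := by
      rw [ContinuousWithinAt, h0]; exact h
    have h2 := continuousWithinAt_Ioi_iff_Ici.1 h1
    rwa [ContinuousWithinAt, h0] at h2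
  have hdiff : ∀ s t : ℝ, 0 ≤ s → 0 ≤ t → ‖S s x - S t x‖ ≤ M * ‖S |s - t| x - x‖ := by
    have aux : ∀ s t : ℝ, 0 ≤ s → s ≤ t → ‖S s x - S t x‖ ≤ M * ‖S (t - s) x - x‖ := by
      intro s t hs hst
      have e : S t x = S s (S (t - s) x) := by
        rw [← ContinuousLinearMap.comp_apply, ← hS.map_add s (t - s) hs (by linarith)]
        congr 2; ring
      rw [e, ← map_sub, norm_sub_rev (S (t - s) x) x]
      exact (S s).le_of_opNorm_le (hM s hs) _
    intro s t hs ht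
    rcases le_total s t with h | h
    · rw [abs_sub_comm, abs_of_nonneg (sub_nonneg.2 h)]
      exact aux s t hs h
    · rw [abs_of_nonneg (sub_nonneg.2 h), norm_sub_rev]
      exact aux t s ht h
  intro t ht
  rw [ContinuousWithinAt, tendsto_iff_norm_sub_tendsto_zero]
  have habs : Tendsto (fun s : ℝ => |s - t|) (𝓝[Set.Ici 0] t) (𝓝[≥] 0) := by
    refine tendsto_nhdsWithin_iff.2
      ⟨?_, Eventually.of_forall fun s => Set.mem_Ici.2 (abs_nonneg _)⟩
    have : Continuous fun s : ℝ => |s - t| := by fun_prop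
    exact (this.tendsto' t 0 (by simp)).mono_left nhdsWithin_le_nhds
  have hlim : Tendsto (fun s : ℝ => M * ‖S |s - t| x - x‖) (𝓝[Set.Ici 0] t) (𝓝 0) := by
    have := (((hzero.comp habs).sub_const x).norm).const_mul M
    simpa using this
  refine squeeze_zero' (Eventually.of_forall fun s => norm_nonneg _) ?_ hlim
  filter_upwards [self_mem_nhdsWithin] with s hs using hdiff s t hs ht

/-- Eigenvectors of the generator are eigenvectors of the semigroup: `exp (l t) S(t) x` has
vanishing right derivative. -/
lemma IsC0Semigroup.apply_eigenvector (hS : IsC0Semigroup S) {M : ℝ}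
    (hM : ∀ t, 0 ≤ t → ‖S t‖ ≤ M) {A : H →ₗ.[ℂ] H} (hA : IsGenerator A S) {l : ℂ} {x : H}
    (hx : ∃ h : x ∈ A.domain, A ⟨x, h⟩ = -l • x) {t : ℝ} (ht : 0 ≤ t) :
    S t x = Complex.exp (-l * t) • x := by
  obtain ⟨hdom, hAx⟩ := hx
  have hgen : Tendsto (fun t : ℝ => ((t⁻¹ : ℝ) : ℂ) • (S t x - x)) (𝓝[>] 0) (𝓝 (-l • x)) := by
    refine (hA x (-l • x)).1 ?_
    rw [← hAx]
    exact A.mem_graph ⟨x, hdom⟩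
  have hderiv : ∀ s, 0 ≤ s → HasDerivWithinAt (fun s => S s x) (S s (-l • x)) (Set.Ici s) s := by
    intro s hs
    rw [← hasDerivWithinAt_Ioi_iff_Ici, hasDerivWithinAt_iff_tendsto_slope' (by simp)]
    have hsub : Tendsto (fun r : ℝ => r - s) (𝓝[>] s) (𝓝[>] 0) := by
      refine tendsto_nhdsWithin_iff.2 ⟨?_, ?_⟩
      · exact ((continuous_sub_right s).tendsto' s 0 (by simp)).mono_left nhdsWithin_le_nhds
      · filter_upwards [self_mem_nhdsWithin] with r hr
          using Set.mem_Ioi.2 (sub_pos.2 (Set.mem_Ioi.1 hr))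
    refine (((S s).continuous.tendsto _).comp (hgen.comp hsub)).congr' ?_
    filter_upwards [self_mem_nhdsWithin] with r hr
    have hr' : s < r := hr
    have e : S r x = S s (S (r - s) x) := by
      rw [← ContinuousLinearMap.comp_apply, ← hS.map_add s (r - s) hs (by linarith)]
      congr 2; ring
    simp only [Function.comp_apply, slope_def_module]
    rw [e, map_smul, map_sub, Complex.coe_smul]
  set f : ℝ → H := fun s => Complex.exp (l * s) • S s x
  have hexp : ∀ s : ℝ,
      HasDerivAt (fun s : ℝ => Complex.exp (l * s)) (Complex.exp (l * s) * l) s := by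
    intro s
    have h1 : HasDerivAt (fun s : ℝ => l * (s : ℂ)) l s := by
      simpa using (Complex.ofRealCLM.hasDerivAt (x := s)).const_mul l
    exact h1.cexp
  have hf : ∀ s ∈ Set.Ico 0 t, HasDerivWithinAt f 0 (Set.Ici s) s := by
    intro s hs
    refine ((hexp s).hasDerivWithinAt.smul (hderiv s hs.1)).congr_deriv ?_
    rw [map_smul, smul_smul, ← add_smul]
    ring_nf
    simp
  have hcont : ContinuousOn f (Set.Icc 0 t) :=
    (Continuous.continuousOn (by fun_prop)).smul
      ((hS.continuousOn hM x).mono Set.Icc_subset_Ici_self)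
  have hconst := constant_of_has_deriv_right_zero hcont hf t ⟨ht, le_rfl⟩
  simp only [f, Complex.ofReal_zero, mul_zero, Complex.exp_zero, hS.map_zero, one_smul,
    ContinuousLinearMap.id_apply] at hconst
  conv_rhs => rw [← hconst]
  rw [smul_smul, ← Complex.exp_add]
  simp

lemma RieszBasis.repr_symm_single (φ : RieszBasis H) (n : ℕ) (c : ℂ) :
    φ.repr.symm (lp.single 2 n c) = c • φ.vec n := by
  rw [RieszBasis.vec, ← map_smul, ← lp.single_smul, smul_eq_mul, mul_one]

/-- An operator that is diagonal on a Riesz basis acts diagonally on coordinates. -/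
lemma RieszBasis.repr_apply_of_diagonal (φ : RieszBasis H) {T : H →L[ℂ] H} {d : ℕ → ℂ}
    (hT : ∀ n, T (φ.vec n) = d n • φ.vec n) (x : H) (n : ℕ) :
    φ.repr (T x) n = d n * φ.repr x n := by
  have hsum : HasSum (fun m => φ.repr x m • φ.vec m) x := by
    have h := (lp.hasSum_single (by norm_num) (φ.repr x)).mapL
      (φ.repr.symm : lp (fun _ : ℕ => ℂ) 2 →L[ℂ] H)
    simpa [RieszBasis.repr_symm_single] using h
  have h1 := (hsum.mapL T).mapL (φ.repr : H →L[ℂ] lp (fun _ : ℕ => ℂ) 2)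
  have h2 := h1.mapL (lp.evalCLM ℂ (fun _ : ℕ => ℂ) 2 n)
  have hvec : ∀ m, φ.repr (φ.vec m) = lp.single 2 m (1 : ℂ) := fun m => by simp [RieszBasis.vec]
  have hterm : ∀ m : ℕ, φ.repr (T (φ.repr x m • φ.vec m)) n
      = if m = n then d n * φ.repr x n else 0 := by
    intro m
    rw [map_smul, hT, smul_smul, map_smul, hvec, lp.coeFn_smul, Pi.smul_apply,
      lp.coeFn_single, smul_eq_mul]
    split_ifs with h
    · subst h; simp [mul_comm]
    · rw [Pi.single_eq_of_ne (Ne.symm h), mul_zero]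
  have h3 : HasSum (fun m : ℕ => if m = n then d n * φ.repr x n else 0) (φ.repr (T x) n) := by
    rw [← funext hterm]
    exact h2
  rw [h3.unique (hasSum_ite_eq n _)]

/-- Exponential stability bounds the spectrum away from the imaginary axis. -/
lemma le_re_of_apply_eigenvector {l : ℂ} {x : H} (hx : ‖x‖ = 1) {α M : ℝ}
    (hM : ∀ t, 0 ≤ t → ‖S t‖ ≤ M * Real.exp (-α * t))
    (hSx : ∀ t : ℝ, 0 ≤ t → S t x = Complex.exp (-l * t) • x) : α ≤ l.re := by
  by_contra! hlt
  have hpos : 0 < α - l.re := sub_pos.2 hlt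
  have key : ∀ t : ℝ, 0 ≤ t → Real.exp ((α - l.re) * t) ≤ M := by
    intro t ht
    have h1 : ‖S t x‖ ≤ M * Real.exp (-α * t) := by
      simpa [hx] using (S t).le_of_opNorm_le (hM t ht) x
    rw [hSx t ht, norm_smul, hx, mul_one, Complex.norm_exp] at h1
    have h2 : (-l * t).re = -l.re * t := by simp
    rw [h2] at h1
    calc Real.exp ((α - l.re) * t) = Real.exp (-l.re * t) * Real.exp (α * t) := by
          rw [← Real.exp_add]; ring_nf
      _ ≤ M * Real.exp (-α * t) * Real.exp (α * t) := by gcongr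
      _ = M := by rw [mul_assoc, ← Real.exp_add]; simp
  have h0 : 1 ≤ M := by simpa using key 0 le_rfl
  have h1 := key (M / (α - l.re)) (by positivity)
  rw [mul_div_cancel₀ _ hpos.ne'] at h1
  linarith [Real.add_one_le_exp M]

end Diagonal

/-! ### Diagonal operators on the extrapolation space -/

namespace ExtrapolationSpace

variable {b : ℕ → ℂ}

lemma ext_coeff {x y : ExtrapolationSpace b} (h : ∀ n, x.coeff n = y.coeff n) : x = y :=
  Subtype.ext (funext h)

lemma toL2_apply (x : ExtrapolationSpace b) (n : ℕ) :
    toL2 b x n = (weight b n : ℂ) * x.coeff n := rfl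

lemma norm_le_of_coeff_le {x y : ExtrapolationSpace b} {c : ℝ} (hc : 0 ≤ c)
    (h : ∀ n, ‖y.coeff n‖ ≤ c * ‖x.coeff n‖) : ‖y‖ ≤ c * ‖x‖ := by
  refine le_of_sq_le_sq ?_ (by positivity)
  rw [mul_pow, norm_sq_eq, norm_sq_eq, ← tsum_mul_left]
  refine Summable.tsum_le_tsum (fun n => ?_) y.2 (x.2.mul_left _)
  rw [← mul_div_assoc, ← mul_pow]
  gcongr
  exact h n

/-- The `n`-th coefficient, as a continuous functional. -/
def coeffCLM (n : ℕ) : ExtrapolationSpace b →L[ℂ] ℂ :=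
  LinearMap.mkContinuous
    (IsLinearMap.mk' (fun x : ExtrapolationSpace b => x.coeff n) ⟨fun _ _ => rfl, fun _ _ => rfl⟩)
    (weight b n)⁻¹ fun x => by
      have h := lp.norm_apply_le_norm (by norm_num) (toL2 b x) n
      rw [toL2_apply, norm_mul, Complex.norm_real, Real.norm_eq_abs,
        abs_of_pos (weight_pos b n)] at h
      rw [inv_mul_eq_div, le_div_iff₀ (weight_pos b n), mul_comm]
      exact h

lemma coeffCLM_apply (x : ExtrapolationSpace b) (n : ℕ) : coeffCLM n x = x.coeff n := rfl

lemma coeff_add (x y : ExtrapolationSpace b) (n : ℕ) :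
    (x + y).coeff n = x.coeff n + y.coeff n := rfl

/-- The formal series with the single term `φ n`. -/
def single (n : ℕ) : ExtrapolationSpace b :=
  (toL2 b).symm (lp.single 2 n (weight b n : ℂ))

lemma coeff_single (n m : ℕ) :
    (single n : ExtrapolationSpace b).coeff m = if m = n then 1 else 0 := by
  have h := toL2_apply (single n : ExtrapolationSpace b) m
  have hw : (weight b m : ℂ) ≠ 0 := by exact_mod_cast (weight_pos b m).ne'
  rw [single, LinearEquiv.apply_symm_apply, lp.coeFn_single] at h
  refine mul_left_cancel₀ hw ?_
  rw [single, ← h]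
  split_ifs with hm
  · subst hm; simp
  · rw [Pi.single_eq_of_ne hm, mul_zero]

lemma hasSum_single (x : ExtrapolationSpace b) : HasSum (fun n => x.coeff n • single n) x := by
  have h := lp.hasSum_single (by norm_num) (toL2 b x)
  have hi : Topology.IsInducing (toL2 b) := isometry_toL2.isUniformInducing.isInducing
  refine (hi.hasSum_iff (g := toL2 b) _ _).1 ?_
  convert h using 1
  ext1 n
  simp only [Function.comp_apply]
  rw [map_smul, single, LinearEquiv.apply_symm_apply, ← lp.single_smul, toL2_apply, smul_eq_mul,
    mul_comm]

end ExtrapolationSpace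

open ExtrapolationSpace

section System

variable {H : Type*} [NormedAddCommGroup H] [InnerProductSpace ℂ H] {S : ℝ → H →L[ℂ] H}
  (φ : RieszBasis H) (b : ℕ → ℂ)

lemma coeff_embed (x : H) (n : ℕ) : (embed b φ x).coeff n = φ.repr x n := rfl

lemma coeff_controlOp (v : ℂ) (n : ℕ) : (controlOp b v).coeff n = v * conj (b n) := rfl

lemma embed_vec (n : ℕ) : embed b φ (φ.vec n) = single n := by
  refine ext_coeff fun m => ?_
  rw [coeff_embed, coeff_single, RieszBasis.vec, ContinuousLinearEquiv.apply_symm_apply,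
    lp.coeFn_single, Pi.single_apply]

lemma denseRange_embed : DenseRange (embed b φ) := by
  intro x
  refine mem_closure_of_tendsto (hasSum_single x) (Eventually.of_forall fun s => ?_)
  refine ⟨∑ n ∈ s, x.coeff n • φ.vec n, ?_⟩
  rw [map_sum]
  exact Finset.sum_congr rfl fun n _ => by rw [map_smul, embed_vec]

variable {φ b}

/-- The extended semigroup acts diagonally on coefficients. -/
lemma coeff_extendedSemigroup {l : ℕ → ℂ} {t : ℝ} (ht : 0 ≤ t) (hl : ∀ n, 0 ≤ (l n).re)
    (hT : ∀ n, S t (φ.vec n) = Complex.exp (-l n * t) • φ.vec n) (x : ExtrapolationSpace b)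
    (n : ℕ) :
    (extendedSemigroup S φ b t x).coeff n = Complex.exp (-l n * t) * x.coeff n := by
  have hrepr := φ.repr_apply_of_diagonal hT
  have hnorm : ∃ C, ∀ y : H,
      ‖((embed b φ).comp (S t).toLinearMap) y‖ ≤ C * ‖embed b φ y‖ := by
    refine ⟨1, fun y => norm_le_of_coeff_le zero_le_one fun n => ?_⟩
    change ‖φ.repr (S t y) n‖ ≤ _
    rw [hrepr, coeff_embed, norm_mul, Complex.norm_exp]
    gcongr
    refine Real.exp_le_one_iff.2 ?_
    simpa using mul_nonneg (hl n) ht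
  have h := (denseRange_embed φ b).equalizer
    (g := fun x => coeffCLM n (extendedSemigroup S φ b t x))
    (h := fun x => Complex.exp (-l n * t) * coeffCLM n x) (by fun_prop) (by fun_prop) (by
      ext y
      simp only [Function.comp_apply, coeffCLM_apply]
      rw [extendedSemigroup, LinearMap.extendOfNorm_eq (denseRange_embed φ b) hnorm, coeff_embed]
      exact hrepr y n)
  exact congrFun h x

lemma controlOp_eq_smul (v : ℂ) : controlOp b v = v • controlOp b 1 := by
  rw [← map_smul, smul_eq_mul, mul_one]

/-- The integrand of the controllability operators is Bochner integrable, and the coefficients of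
its integral are the integrals of its coefficients. -/
lemma coeff_setIntegral_extendedSemigroup {l : ℕ → ℂ} {α : ℝ} (hα : 0 < α)
    (hl : ∀ n, α ≤ (l n).re)
    (hT : ∀ t : ℝ, 0 ≤ t → ∀ n, S t (φ.vec n) = Complex.exp (-l n * t) • φ.vec n)
    {s : Set ℝ} (hs : MeasurableSet s) (hs0 : s ⊆ Set.Ici 0) {u : ℝ → ℂ}
    (hu : AEStronglyMeasurable u (volume.restrict s))
    (hint : IntegrableOn (fun t => Real.exp (-α * t) * ‖u t‖) s) (n : ℕ) :
    (∫ t in s, extendedSemigroup S φ b t (controlOp b (u t))).coeff n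
      = conj (b n) * ∫ t in s, Complex.exp (-l n * t) * u t := by
  have hcoeff : ∀ t ∈ s, ∀ x : ExtrapolationSpace b, ∀ n,
      (extendedSemigroup S φ b t x).coeff n = Complex.exp (-l n * t) * x.coeff n :=
    fun t ht => coeff_extendedSemigroup (hs0 ht) (fun n => hα.le.trans (hl n)) (hT t (hs0 ht))
  -- measurability is inherited from the partial sums of the expansion in `H_B`
  have hmeas : AEStronglyMeasurable (fun t => extendedSemigroup S φ b t (controlOp b (u t)))
      (volume.restrict s) := by
    refine aestronglyMeasurable_of_tendsto_ae atTop (f := fun (N : ℕ) (t : ℝ) =>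
      ∑ n ∈ Finset.range N, (Complex.exp (-l n * t) * (u t * conj (b n))) •
        (single n : ExtrapolationSpace b)) (fun N => ?_) ?_
    · refine Finset.aestronglyMeasurable_fun_sum _ fun n _ => ?_
      refine AEStronglyMeasurable.smul_const ?_ _
      exact (Continuous.aestronglyMeasurable (by fun_prop)).mul (hu.mul_const _)
    · refine (ae_restrict_iff' hs).2 (Eventually.of_forall fun t ht => ?_)
      have h := (hasSum_single (extendedSemigroup S φ b t (controlOp b (u t)))).tendsto_sum_nat
      simpa only [hcoeff t ht, coeff_controlOp] using h
  have hI : Integrable (fun t => extendedSemigroup S φ b t (controlOp b (u t)))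
      (volume.restrict s) := by
    refine (hint.mul_const ‖controlOp b 1‖).mono' hmeas ?_
    refine (ae_restrict_iff' hs).2 (Eventually.of_forall fun t ht => ?_)
    rw [mul_assoc, ← norm_smul, ← controlOp_eq_smul]
    refine norm_le_of_coeff_le (Real.exp_pos _).le fun n => ?_
    rw [hcoeff t ht, norm_mul, Complex.norm_exp]
    gcongr
    have : (-l n * t).re = -((l n).re * t) := by simp
    rw [this, neg_mul]
    have ht0 : 0 ≤ t := hs0 ht
    have := hl n
    gcongr
  rw [← coeffCLM_apply, ← ContinuousLinearMap.integral_comp_comm _ hI, ← integral_const_mul]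
  refine setIntegral_congr_fun hs fun t ht => ?_
  rw [coeffCLM_apply, hcoeff t ht, coeff_controlOp]
  ring

end System

/-! ### Controllability as a moment problem -/

/-- Every sequence in `ℓ²` is of the form `(c n * y n)` with `y` in the set `T`. -/
def SolvesAll (T : Set (ℕ → ℂ)) (c : ℕ → ℂ) : Prop :=
  ∀ a : ℕ → ℂ, Memℓp a 2 → ∃ y ∈ T, ∀ n, c n * y n = a n

lemma SolvesAll.ne_zero {T : Set (ℕ → ℂ)} {c : ℕ → ℂ} (h : SolvesAll T c) (n : ℕ) : c n ≠ 0 := by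
  obtain ⟨y, -, hy⟩ := h _ (lp.memℓp (lp.single 2 n (1 : ℂ)))
  have := hy n
  rw [lp.single_apply_self] at this
  exact left_ne_zero_of_mul (this.trans_ne one_ne_zero)

/-- Solvability depends only on the moduli of the factors, since `ℓ²` is invariant under
multiplication by unimodular sequences. -/
lemma SolvesAll.of_norm_eq {T : Set (ℕ → ℂ)} {c d : ℕ → ℂ} (h : SolvesAll T c)
    (hcd : ∀ n, ‖c n‖ = ‖d n‖) : SolvesAll T d := by
  intro a ha
  have hd : ∀ n, d n ≠ 0 := fun n => by
    rw [← norm_ne_zero_iff, ← hcd, norm_ne_zero_iff]; exact h.ne_zero n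
  have ha' : Memℓp (fun n => c n / d n * a n) 2 := by
    rw [memℓp_gen_iff (by norm_num)] at ha ⊢
    refine ha.congr fun n => ?_
    rw [norm_mul, norm_div, hcd, div_self (norm_ne_zero_iff.2 (hd n)), one_mul]
  obtain ⟨y, hy, hya⟩ := h _ ha'
  refine ⟨y, hy, fun n => ?_⟩
  have h1 := hya n
  have h2 := h.ne_zero n
  have h3 := hd n
  refine mul_left_cancel₀ h2 ?_
  rw [mul_left_comm, h1]
  field_simp

lemma solvesAll_congr {T : Set (ℕ → ℂ)} {c d : ℕ → ℂ} (hcd : ∀ n, ‖c n‖ = ‖d n‖) :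
    SolvesAll T c ↔ SolvesAll T d :=
  ⟨fun h => h.of_norm_eq hcd, fun h => h.of_norm_eq fun n => (hcd n).symm⟩

lemma weightedInterpolating_iff {Ω : Set ℂ} {X : Set (ℂ → ℂ)} {μ : ℕ → ℂ} {ω : ℕ → ℝ}
    (hμ : ∀ n, μ n ∈ Ω) (hω : ∀ n, 0 ≤ ω n) :
    WeightedInterpolating 2 Ω X μ ω ↔ SolvesAll ((fun f n => f (μ n)) '' X) fun n => ω n := by
  constructor
  · rintro ⟨-, -, h⟩ a ha
    obtain ⟨f, hf, hfa⟩ := h a ha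
    exact ⟨_, ⟨f, hf, rfl⟩, hfa⟩
  · intro h
    refine ⟨hμ, fun n => (hω n).lt_of_ne' (by exact_mod_cast h.ne_zero n), fun a ha => ?_⟩
    obtain ⟨_, ⟨f, hf, rfl⟩, hfa⟩ := h a ha
    exact ⟨f, hf, hfa⟩

/-- The sequences of moments `∫ exp (i μ n t) v t dt` of functions `v ∈ L²(s)`. -/
def momentSet (s : Set ℝ) (μ : ℕ → ℂ) : Set (ℕ → ℂ) :=
  (fun v n => ∫ t in s, Complex.exp (Complex.I * μ n * t) * v t) ''
    {v : ℝ → ℂ | MemLp v 2 (volume.restrict s)}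

/-- The moments over `(0, ∞)` are the values of functions in `H²`. -/
lemma momentSet_Ioi {μ : ℕ → ℂ} (hμ : ∀ n, 0 < (μ n).im) :
    momentSet (Set.Ioi 0) μ = (fun f n => f (μ n)) '' HardyUpper 2 := by
  ext y
  constructor
  · rintro ⟨v, hv, rfl⟩
    exact ⟨_, hardyUpper_integral_exp hv, rfl⟩
  · rintro ⟨f, hf, rfl⟩
    obtain ⟨v, hv, hvf⟩ := exists_integral_exp_of_hardyUpper hf
    exact ⟨v, hv, funext fun n => hvf _ (hμ n)⟩

/-- The moments over `(0, 2σ)` are, up to exponential factors, the values of functions in the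
Paley–Wiener space. -/
lemma solvesAll_momentSet_Ioo {μ : ℕ → ℂ} (hμ : ∀ n, 0 < (μ n).im) {σ : ℝ} (hσ : 0 < σ)
    (c : ℕ → ℂ) :
    SolvesAll (momentSet (Set.Ioo 0 (2 * σ)) μ) c ↔
      SolvesAll ((fun f n => f (μ n)) '' PaleyWiener 2 σ)
        fun n => c n * Complex.exp (Complex.I * σ * μ n) := by
  refine forall₂_congr fun a _ => ⟨?_, ?_⟩
  · rintro ⟨_, ⟨v, hv, rfl⟩, ha⟩
    refine ⟨_, ⟨_, paleyWiener_integral_exp hv, rfl⟩, fun n => ?_⟩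
    rw [← ha n, mul_assoc]
    congr 1
    beta_reduce
    rw [← mul_assoc, ← Complex.exp_add, add_neg_cancel, Complex.exp_zero, one_mul]
  · rintro ⟨_, ⟨f, hf, rfl⟩, ha⟩
    obtain ⟨v, hv, hvf⟩ := exists_integral_exp_of_paleyWiener hσ hf
    refine ⟨_, ⟨v, hv, rfl⟩, fun n => ?_⟩
    rw [← ha n, mul_assoc]
    congr 1
    exact hvf _ (hμ n)

section System

variable {H : Type*} [NormedAddCommGroup H] [InnerProductSpace ℂ H] {S : ℝ → H →L[ℂ] H}
  {φ : RieszBasis H} {b : ℕ → ℂ} {l : ℕ → ℂ} {α : ℝ}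

lemma exp_I_mul_I_mul (z : ℂ) (t : ℝ) :
    Complex.exp (Complex.I * (Complex.I * z) * t) = Complex.exp (-z * t) := by
  rw [← mul_assoc, Complex.I_mul_I]
  ring_nf

/-- Controllability in infinite time is solvability of the moment problem on `(0, ∞)`. -/
lemma exactlyControllableInfty_iff (hα : 0 < α) (hl : ∀ n, α ≤ (l n).re)
    (hT : ∀ t : ℝ, 0 ≤ t → ∀ n, S t (φ.vec n) = Complex.exp (-l n * t) • φ.vec n) :
    ExactlyControllableInfty S φ b ↔
      SolvesAll (momentSet (Set.Ioi 0) fun n => Complex.I * l n) fun n => conj (b n) := by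
  have hcoeff : ∀ u : ℝ → ℂ, MemLp u 2 (volume.restrict (Set.Ioi 0)) → ∀ n,
      (controllabilityOpInfty S φ b u).coeff n
        = conj (b n) * ∫ t in Set.Ioi (0 : ℝ),
          Complex.exp (Complex.I * (Complex.I * l n) * t) * u t := by
    intro u hu n
    simp_rw [exp_I_mul_I_mul]
    refine coeff_setIntegral_extendedSemigroup hα hl hT measurableSet_Ioi Set.Ioi_subset_Ici_self
      hu.1 ?_ n
    have he := memLp_exp_I_mul (z := (α : ℂ) * Complex.I) (by simpa using hα)
    refine ((he.integrable_mul hu).norm).congr (Eventually.of_forall fun t => ?_)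
    simp only [Pi.mul_apply, norm_mul, norm_exp_I_mul]
    simp
  constructor
  · intro h a ha
    obtain ⟨u, hu, hua⟩ := h (φ.repr.symm ⟨a, ha⟩)
    refine ⟨_, ⟨u, hu, rfl⟩, fun n => ?_⟩
    beta_reduce
    rw [← hcoeff u hu, hua, coeff_embed, ContinuousLinearEquiv.apply_symm_apply]
  · intro h x
    obtain ⟨_, ⟨u, hu, rfl⟩, hua⟩ := h _ (lp.memℓp (φ.repr x))
    exact ⟨u, hu, ExtrapolationSpace.ext_coeff fun n => (hcoeff u hu n).trans (hua n)⟩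

lemma memLp_comp_sub_left {u : ℝ → ℂ} {τ : ℝ} (hu : MemLp u 2 (volume.restrict (Set.Ioo 0 τ))) :
    MemLp (fun t => u (τ - t)) 2 (volume.restrict (Set.Ioo 0 τ)) := by
  have h := (Measure.measurePreserving_sub_left (volume : Measure ℝ) τ).restrict_preimage
    (measurableSet_Ioo (a := (0 : ℝ)) (b := τ))
  have hpre : (fun t : ℝ => τ - t) ⁻¹' Set.Ioo 0 τ = Set.Ioo 0 τ := by
    simp
  rw [hpre] at h
  exact hu.comp_measurePreserving h

/-- Controllability in time `τ` is solvability of the moment problem on `(0, τ)`: the difference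
`x₁ - S τ x₀` ranges over all of `H`, and reversal of time turns inputs into densities. -/
lemma exactlyControllable_iff (hS : IsC0Semigroup S) (hα : 0 < α) (hl : ∀ n, α ≤ (l n).re)
    (hT : ∀ t : ℝ, 0 ≤ t → ∀ n, S t (φ.vec n) = Complex.exp (-l n * t) • φ.vec n) {τ : ℝ}
    (hτ : 0 < τ) :
    ExactlyControllable S φ b τ ↔
      SolvesAll (momentSet (Set.Ioo 0 τ) fun n => Complex.I * l n) fun n => conj (b n) := by
  have hcoeff : ∀ u : ℝ → ℂ, MemLp u 2 (volume.restrict (Set.Ioo 0 τ)) → ∀ n,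
      (controllabilityOp S φ b τ u).coeff n = conj (b n) * ∫ t in Set.Ioo (0 : ℝ) τ,
        Complex.exp (Complex.I * (Complex.I * l n) * t) * u (τ - t) := by
    intro u hu n
    have hu' := memLp_comp_sub_left hu
    have h1 : controllabilityOp S φ b τ u
        = ∫ t in Set.Ioo (0 : ℝ) τ, extendedSemigroup S φ b t (controlOp b (u (τ - t))) := by
      have h := intervalIntegral.integral_comp_sub_left (a := 0) (b := τ)
        (fun t => extendedSemigroup S φ b t (controlOp b (u (τ - t)))) τ
      simp only [sub_sub_cancel, sub_self, sub_zero] at h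
      rw [controllabilityOp, h, intervalIntegral.integral_of_le hτ.le, integral_Ioc_eq_integral_Ioo]
    simp_rw [exp_I_mul_I_mul]
    rw [h1]
    refine coeff_setIntegral_extendedSemigroup hα hl hT measurableSet_Ioo (fun t ht => ht.1.le)
      hu'.1 ?_ n
    refine (hu'.integrable one_le_two).norm.mono' ((Continuous.aestronglyMeasurable
      (by fun_prop)).mul hu'.1.norm) ?_
    refine (ae_restrict_iff' measurableSet_Ioo).2 (Eventually.of_forall fun t ht => ?_)
    rw [norm_mul, norm_norm, Real.norm_eq_abs, Real.abs_exp]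
    refine mul_le_of_le_one_left (norm_nonneg _) (Real.exp_le_one_iff.2 ?_)
    rw [neg_mul]
    exact neg_nonpos.2 (mul_pos hα ht.1).le
  constructor
  · intro h a ha
    obtain ⟨u, hu, -, hua⟩ := h 0 (φ.repr.symm ⟨a, ha⟩)
    refine ⟨_, ⟨_, memLp_comp_sub_left hu, rfl⟩, fun n => ?_⟩
    beta_reduce
    rw [← hcoeff u hu]
    rw [solution, map_zero, map_zero, zero_add] at hua
    rw [hua, coeff_embed, ContinuousLinearEquiv.apply_symm_apply]
  · intro h x₀ x₁
    obtain ⟨_, ⟨v, hv, rfl⟩, hva⟩ := h _ (lp.memℓp (φ.repr (x₁ - S τ x₀)))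
    refine ⟨fun t => v (τ - t), memLp_comp_sub_left hv, ?_, ?_⟩
    · rw [solution, controllabilityOp, intervalIntegral.integral_same, add_zero, hS.map_zero]
      rfl
    · refine ExtrapolationSpace.ext_coeff fun n => ?_
      rw [solution, ExtrapolationSpace.coeff_add, hcoeff _ (memLp_comp_sub_left hv)]
      simp only [sub_sub_cancel]
      refine (congrArg _ (hva n)).trans ?_
      rw [coeff_embed, coeff_embed, map_sub]
      simp

end System

end ExactControl

end

theorem mainTheorem7 {H : Type*} [NormedAddCommGroup H] [InnerProductSpace ℂ H] [CompleteSpace H]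
    (S : ℝ → H →L[ℂ] H) (hS : ExactControl.IsC0Semigroup S)
    (hstable : ExactControl.ExponentiallyStable S)
    (A : H →ₗ.[ℂ] H) (hA : ExactControl.IsGenerator A S)
    (φ : ExactControl.RieszBasis H) (hφ : ∀ n, ‖φ.vec n‖ = 1)
    (l : ℕ → ℂ)
    (heig : ∀ n, ∃ h : φ.vec n ∈ A.domain, A ⟨φ.vec n, h⟩ = -l n • φ.vec n)
    (hBlaschke : Summable fun n => (l n).re / (1 + ‖l n‖ ^ 2))
    (b : ℕ → ℂ) :
    (∀ τ : ℝ, 0 < τ →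
      (ExactControl.ExactlyControllable S φ b τ ↔
        ExactControl.WeightedInterpolating 2 Set.univ (ExactControl.PaleyWiener 2 (τ / 2))
          (fun n => Complex.I * l n)
          (fun n => Real.exp (-(τ / 2) * (Complex.I * l n).im) * ‖b n‖))) ∧
    (ExactControl.ExactlyControllableInfty S φ b ↔
      ExactControl.WeightedInterpolating 2 {z : ℂ | 0 < z.im} (ExactControl.HardyUpper 2)
        (fun n => Complex.I * l n) (fun n => ‖b n‖)) := by
  obtain ⟨α, hα, M, hM1, hM⟩ := hstable
  have hM' : ∀ t, 0 ≤ t → ‖S t‖ ≤ M := fun t ht => (hM t ht).trans <|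
    mul_le_of_le_one_right (by linarith) (Real.exp_le_one_iff.2 (by nlinarith))
  have hT : ∀ t : ℝ, 0 ≤ t → ∀ n, S t (φ.vec n) = Complex.exp (-l n * t) • φ.vec n :=
    fun t ht n => hS.apply_eigenvector hM' hA (heig n) ht
  have hl : ∀ n, α ≤ (l n).re := fun n =>
    ExactControl.le_re_of_apply_eigenvector (hφ n) hM fun t ht => hT t ht n
  have hμ : ∀ n, 0 < (Complex.I * l n).im := fun n => by simpa using hα.trans_le (hl n)
  refine ⟨fun τ hτ => ?_, ?_⟩
  · rw [ExactControl.exactlyControllable_iff hS hα hl hT hτ,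
      ExactControl.weightedInterpolating_iff (fun _ => Set.mem_univ _) (fun n => by positivity)]
    have h := ExactControl.solvesAll_momentSet_Ioo hμ (half_pos hτ) fun n => conj (b n)
    rw [mul_div_cancel₀ τ two_ne_zero] at h
    rw [h]
    refine ExactControl.solvesAll_congr fun n => ?_
    rw [norm_mul, RCLike.norm_conj, Complex.norm_exp, Complex.norm_real, norm_mul, norm_norm,
      Real.norm_eq_abs, Real.abs_exp, mul_comm]
    congr 2
    simp
  · rw [ExactControl.exactlyControllableInfty_iff hα hl hT,
      ExactControl.weightedInterpolating_iff hμ (fun n => norm_nonneg _),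
      ExactControl.momentSet_Ioi hμ]
    exact ExactControl.solvesAll_congr fun n => by simp
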